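/- Let $\mathcal X,\mathcal Y$ be finite nonempty alphabets and let $W=(W(y|x))_{x\in\mathcal X,\,y\in\mathcal Y}$ be a stochastic matrix (a discrete memoryless channel). Call $W$ *singular* if for all $x,z\in\mathcal X$ and $y\in\mathcal Y$ with $W(y|x)W(y|z)>0$ one has $W(y|x)=W(y|z)$. Call $W$ *symmetric* (in Gallager's sense) if $\mathcal Y$ can be partitioned into blocks such that, within the submatrix of $W$ belonging to each block, every row is a permutation of every other row and every column is a permutation of every other column; otherwise $W$ is *asymmetric*. For a probability distribution $P$ on $\mathcal X$ let $q_P(y)=\sum_x P(x)W(y|x)$, $I(P;W)=\sum_{x,y}P(x)W(y|x)\ln\frac{W(y|x)}{q_P(y)}$, $C(W)=\max_P I(P;W)$ and $$V(P,W)=\sum_{x,y}P(x)W(y|x)\Big[\ln\tfrac{W(y|x)}{q_P(y)}-\sum_b W(b|x)\ln\tfrac{W(b|x)}{q_P(b)}\Big]^2 .$$ For $\epsilon\in(0,1)$ let $V_\epsilon(W)$ be the minimum (if $\epsilon<1/2$) or the maximum (if $\epsilon\ge 1/2$) of $V(Q,W)$ over all distributions $Q$ with $I(Q;W)=C(W)$.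 Let $\Phi$ be the standard normal distribution function. An $(N,R)$ constant composition code consists of an encoder $f:\mathcal M\to\mathcal X^N$, $\mathcal M=\{1,\dots,\lceil e^{NR}\rceil\}$, all of whose codewords have the same empirical distribution, and a decoder $\varphi:\mathcal Y^N\to\mathcal M$. Its average error probability is $\frac1{|\mathcal M|}\sum_{m}\sum_{\mathbf y:\varphi(\mathbf y)\ne m}\prod_{n=1}^N W(y_n|f(m)_n)$. Let $\bar{\mathrm P}_{\mathrm e,\mathrm c}(N,R)$ be the minimum of this quantity over all such codes and let $M^*_{\mathrm c}(N,\epsilon)=\max\{\lceil e^{NR}\rceil : R\ge 0,\ \bar{\mathrm P}_{\mathrm e,\mathrm c}(N,R)\le\epsilon\}$. Theorem. Let $W$ be singular and asymmetric. (i) If $\epsilon\in(0,1/2)$, there is a constant $\tilde K(\epsilon,W)>0$, depending only on $\epsilon$ and $W$, such that for all $N\ge 1$, $$\ln M^*_{\mathrm c}(N,\epsilon)\le N\,C(W)+\sqrt{N\,V_\epsilon(W)}\;\Phi^{-1}(\epsilon)+\tilde K(\epsilon,W).$$ (ii) If $\epsilon\in(1/2,1)$ and $V_\epsilon(W)>0$,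 there is a constant $\hat K(\epsilon,W)>0$, depending only on $\epsilon$ and $W$, such that for all $N\ge 1$, $$\ln M^*_{\mathrm c}(N,\epsilon)\le N\,C(W)+\sqrt{N\,V_\epsilon(W)}\;\Phi^{-1}(\epsilon)+\hat K(\epsilon,W).$$ -/

import Mathlib

open scoped BigOperators

noncomputable section

namespace DMC

variable {X Y : Type*} [Fintype X] [Fintype Y]

/-- `W` is a channel (stochastic matrix) from `X` to `Y`; `W x y` is the probability `W(y|x)`. -/
def IsChannel (W : X → Y → ℝ) : Prop :=
  ∀ x, W x ∈ stdSimplex ℝ Y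

/-- Gallager symmetry: the output alphabet can be partitioned so that, in the submatrix belonging
to each block, all rows are permutations of each other and all columns are permutations of each
other. -/
def IsSymmetric (W : X → Y → ℝ) : Prop :=
  ∃ 𝓑 : Set (Set Y), Setoid.IsPartition 𝓑 ∧ ∀ B ∈ 𝓑,
    (∀ x x' : X, ∃ σ : Equiv.Perm B, ∀ y : B, W x' (σ y) = W x y) ∧
    (∀ y ∈ B, ∀ y' ∈ B, ∃ π : Equiv.Perm X, ∀ x : X, W (π x) y' = W x y)

/-- Singularity: within each column, all positive entries agree. -/
def IsSingular (W : X → Y → ℝ) : Prop :=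
  ∀ (x : X) (y : Y) (z : X), 0 < W x y * W z y → W x y = W z y

/-- The output distribution `q_P`. -/
def outputDist (P : X → ℝ) (W : X → Y → ℝ) (y : Y) : ℝ :=
  ∑ x, P x * W x y

/-- Mutual information `I(P;W)`, in nats. Terms with `P x * W x y = 0` vanish, and in all the
other terms the argument of the logarithm is a quotient of positive numbers. -/
def mutualInfo (P : X → ℝ) (W : X → Y → ℝ) : ℝ :=
  ∑ x, ∑ y, P x * W x y * Real.log (W x y / outputDist P W y)

/-- Capacity `C(W)`: the maximum of `I(P;W)` over the input distributions `P`. -/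
def capacity (W : X → Y → ℝ) : ℝ :=
  sSup ((fun P => mutualInfo P W) '' stdSimplex ℝ X)

/-- The conditional information variance `V(P,W)`. -/
def dispersion (P : X → ℝ) (W : X → Y → ℝ) : ℝ :=
  ∑ x, ∑ y, P x * W x y *
    (Real.log (W x y / outputDist P W y)
      - ∑ b, W x b * Real.log (W x b / outputDist P W b)) ^ 2

/-- The input distributions that achieve capacity. -/
def optimalInputs (W : X → Y → ℝ) : Set (X → ℝ) :=
  {P | P ∈ stdSimplex ℝ X ∧ mutualInfo P W = capacity W}

/-- The `ε`-dispersion `V_ε(W)`: the minimum (for `ε < 1/2`) or maximum (for `ε ≥ 1/2`) of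
`V(P,W)` over the capacity-achieving input distributions `P`. -/
def epsDispersion (ε : ℝ) (W : X → Y → ℝ) : ℝ :=
  if ε < 1 / 2 then sInf ((fun P => dispersion P W) '' optimalInputs W)
  else sSup ((fun P => dispersion P W) '' optimalInputs W)

/-- A block code with blocklength `N` and `M` messages. -/
structure Code (X Y : Type*) (N M : ℕ) where
  /-- the encoder -/
  enc : Fin M → (Fin N → X)
  /-- the decoder -/
  dec : (Fin N → Y) → Fin M

/-- The probability `W(y^N|x^N)` of the output word `y` given the input word `x`. -/
def wordProb (W : X → Y → ℝ) {N : ℕ} (x : Fin N → X) (y : Fin N → Y) : ℝ :=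
  ∏ i, W (x i) (y i)

/-- The average error probability of a code. -/
def avgError (W : X → Y → ℝ) {N M : ℕ} (c : Code X Y N M) : ℝ :=
  (1 / (M : ℝ)) * ∑ m : Fin M, ∑ y : Fin N → Y with c.dec y ≠ m, wordProb W (c.enc m) y

open Classical in
/-- The empirical distribution (composition) of a word. -/
def empiricalDist {N : ℕ} (x : Fin N → X) (a : X) : ℝ :=
  (Finset.card {i : Fin N | x i = a} : ℝ) / (N : ℝ)

/-- All codewords have the same empirical distribution. -/
def Code.ConstantComposition {N M : ℕ} (c : Code X Y N M) : Prop :=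
  ∀ m m' : Fin M, empiricalDist (c.enc m) = empiricalDist (c.enc m')

/-- The number `⌈e^{NR}⌉` of messages of an `(N,R)` code. -/
def numMessages (N : ℕ) (R : ℝ) : ℕ :=
  ⌈Real.exp ((N : ℝ) * R)⌉₊

/-- The minimum average error probability of `(N,R)` constant composition codes. (There are only
finitely many such codes, and at least one if `N ≥ 1` and `X` is nonempty.) -/
def minErrorCC (W : X → Y → ℝ) (N : ℕ) (R : ℝ) : ℝ :=
  sInf {e | ∃ c : Code X Y N (numMessages N R), c.ConstantComposition ∧ e = avgError W c}

/-- The sizes `⌈e^{NR}⌉`, `R ≥ 0`, attainable by constant composition codes of blocklength `N`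
with average error probability at most `ε`. -/
def codeSizesCC (W : X → Y → ℝ) (N : ℕ) (ε : ℝ) : Set ℕ :=
  {M | ∃ R : ℝ, 0 ≤ R ∧ M = numMessages N R ∧ minErrorCC W N R ≤ ε}

/-- `M*_c(N,ε)`: the maximal size of a constant composition code of blocklength `N` with average
error probability at most `ε`. -/
def maxCodeSizeCC (W : X → Y → ℝ) (N : ℕ) (ε : ℝ) : ℕ :=
  sSup (codeSizesCC W N ε)

/-- The inverse `Φ⁻¹` of the standard normal distribution function `Φ`, as its quantile function. -/
def stdNormalInv (p : ℝ) : ℝ :=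
  sInf {t : ℝ | p ≤ ProbabilityTheory.cdf (ProbabilityTheory.gaussianReal 0 1) t}

end DMC

end

/-! In a singular channel every column is a constant times a 0-1 vector, W(y|x) = w(y)·1{W(y|x) >
0}. Hence q_P(y) = w(y) r_P(y), where r_P(y) is the P-probability of a letter that can produce y,
and the information density ln W(y|x)/q_P(y) equals -ln r_P(y): it depends on the output alone
(`eq_colValue_mul`, `mul_log_eq`).

This removes the logarithmic term. Let P be the composition of the code and S the sum of the
densities of the N output letters. Where S ≥ ln M, the likelihood of the decoded word is bounded by
the sum over all messages. Elsewhere it is at most q_P(y)e^S, whichever word was decoded, and after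
division by M this contributes the q_P-expectation of e^{S - ln M} on S < ln M. Cutting into unit
slabs and applying Berry-Esseen under the product of q_P shows that this is O(1/√N). A second
Berry-Esseen bound, under the codeword's own law, gives Φ((ln M - N I(P))/√(N V(P))) ≤ ε + O(1/√N)
(`one_sub_avgError_le`, `stdNormalCDF_log_card_le`). Inverting Φ costs only a constant. Berry-Esseen
itself is proved by Stein's method (`prodExp_smooth_le`).

It remains to be uniform in P. Relative to a fixed optimal Q, let D ≥ 0 be the Kuhn-Tucker gap of P
and R a weighted distance between r_P and r_Q. Then I(P) ≤ C - D - R²/4 (`mutualInfo_le_sub`), and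
near the optimum |V(P) - V_ε| ≤ L(R + D) (`exists_abs_avgVar_sub_le`); all optimal inputs share one
dispersion (`epsDispersion_eq`). The deviation √N(R + D) in the second-order term is therefore
absorbed by the loss N(D + R²/4), up to a constant. Far from the optimum, or for bounded N,
Chebyshev's inequality suffices. If V_ε = 0, then V(P) = O(R²), and Chebyshev together with the same
absorption finishes the proof. -/

noncomputable section

namespace DMC

/-! ### The normal law and Stein's equation -/

section Gaussian

open MeasureTheory ProbabilityTheory Set Filter Topology

/-- The standard normal density. -/
abbrev stdNormalPDF : ℝ → ℝ := gaussianPDFReal 0 1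

/-- The standard normal distribution function. -/
abbrev stdNormalCDF (t : ℝ) : ℝ := cdf (gaussianReal 0 1) t

lemma stdNormalPDF_eq (t : ℝ) :
    stdNormalPDF t = (Real.sqrt (2 * Real.pi))⁻¹ * Real.exp (-t ^ 2 / 2) := by
  simp [stdNormalPDF, gaussianPDFReal]

lemma stdNormalPDF_pos (t : ℝ) : 0 < stdNormalPDF t :=
  gaussianPDFReal_pos 0 1 t one_ne_zero

lemma stdNormalPDF_neg (t : ℝ) : stdNormalPDF (-t) = stdNormalPDF t := by
  simp [stdNormalPDF_eq]

lemma hasDerivAt_stdNormalPDF (t : ℝ) : HasDerivAt stdNormalPDF (-t * stdNormalPDF t) t := by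
  have h : HasDerivAt (fun t : ℝ => -t ^ 2 / 2) (-t) t := by
    have := ((hasDerivAt_pow 2 t).neg.div_const 2)
    convert! this using 1
    push_cast
    ring
  have h2 := (h.exp.const_mul (Real.sqrt (2 * Real.pi))⁻¹)
  have h3 : stdNormalPDF = fun t => (Real.sqrt (2 * Real.pi))⁻¹ * Real.exp (-t ^ 2 / 2) := by
    ext t; exact stdNormalPDF_eq t
  rw [h3]
  convert! h2 using 1
  ring

lemma continuous_stdNormalPDF : Continuous stdNormalPDF :=
  continuous_iff_continuousAt.2 fun t => (hasDerivAt_stdNormalPDF t).continuousAt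

lemma integrable_stdNormalPDF : Integrable stdNormalPDF := integrable_gaussianPDFReal 0 1

lemma integral_stdNormalPDF : ∫ t, stdNormalPDF t = 1 :=
  integral_gaussianPDFReal_eq_one 0 one_ne_zero

lemma stdNormalCDF_eq (t : ℝ) : stdNormalCDF t = ∫ x in Iic t, stdNormalPDF x := by
  rw [stdNormalCDF, cdf_eq_real, Measure.real, gaussianReal_apply_eq_integral _ one_ne_zero,
    ENNReal.toReal_ofReal]
  exact integral_nonneg fun x => (stdNormalPDF_pos x).le

lemma stdNormalPDF_le_one (t : ℝ) : stdNormalPDF t ≤ 1 := by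
  rw [stdNormalPDF_eq]
  have h1 : Real.exp (-t ^ 2 / 2) ≤ 1 := Real.exp_le_one_iff.2 (by nlinarith [sq_nonneg t])
  have h2 : (Real.sqrt (2 * Real.pi))⁻¹ ≤ 1 := by
    apply inv_le_one_of_one_le₀
    rw [Real.one_le_sqrt]
    linarith [Real.pi_gt_three]
  exact mul_le_one₀ h2 (Real.exp_pos _).le h1

lemma hasDerivAt_integral_Iic {u : ℝ → ℝ} (hu : Continuous u) (hi : Integrable u) (w : ℝ) :
    HasDerivAt (fun w => ∫ t in Iic w, u t) (u w) w := by
  have h : (fun w => ∫ t in Iic w, u t) = fun w => (∫ t in Iic 0, u t) + ∫ t in (0 : ℝ)..w, u t := by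
    ext w
    rw [← intervalIntegral.integral_Iic_sub_Iic hi.integrableOn hi.integrableOn]
    ring
  rw [h]
  exact (intervalIntegral.integral_hasDerivAt_right (hu.intervalIntegrable _ _)
    (hu.stronglyMeasurableAtFilter _ _) hu.continuousAt).const_add _

lemma hasDerivAt_stdNormalCDF (w : ℝ) : HasDerivAt stdNormalCDF (stdNormalPDF w) w := by
  have h := hasDerivAt_integral_Iic continuous_stdNormalPDF integrable_stdNormalPDF w
  have h2 : stdNormalCDF = fun w => ∫ t in Iic w, stdNormalPDF t := by
    ext t; exact stdNormalCDF_eq t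
  rwa [h2]

lemma stdNormalCDF_sub_le {a b : ℝ} (hab : a ≤ b) :
    stdNormalCDF b - stdNormalCDF a ≤ b - a := by
  rcases hab.eq_or_lt with rfl | hab
  · simp
  obtain ⟨c, -, hc⟩ := exists_hasDerivAt_eq_slope stdNormalCDF stdNormalPDF hab
    (fun x _ => (hasDerivAt_stdNormalCDF x).continuousAt.continuousWithinAt)
    (fun x _ => hasDerivAt_stdNormalCDF x)
  have h := stdNormalPDF_le_one c
  rw [hc, div_le_one (sub_pos.2 hab)] at h
  exact h

/-- The normal distribution function grows at least linearly on bounded intervals. -/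
lemma exists_le_stdNormalCDF_sub (R : ℝ) :
    ∃ κ : ℝ, 0 < κ ∧ ∀ a b, -R ≤ a → a ≤ b → b ≤ R →
      κ * (b - a) ≤ stdNormalCDF b - stdNormalCDF a := by
  refine ⟨stdNormalPDF R, stdNormalPDF_pos R, fun a b ha hab hb => ?_⟩
  rcases hab.eq_or_lt with rfl | hab
  · simp
  obtain ⟨c, hcm, hc⟩ := exists_hasDerivAt_eq_slope stdNormalCDF stdNormalPDF hab
    (fun x _ => (hasDerivAt_stdNormalCDF x).continuousAt.continuousWithinAt)
    (fun x _ => hasDerivAt_stdNormalCDF x)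
  have h : stdNormalPDF R ≤ stdNormalPDF c := by
    rw [stdNormalPDF_eq, stdNormalPDF_eq]
    have : c ^ 2 ≤ R ^ 2 := sq_le_sq' (by linarith [hcm.1]) (by linarith [hcm.2])
    gcongr 2
    linarith
  rw [hc, le_div_iff₀ (sub_pos.2 hab)] at h
  exact h

lemma integral_Ioi_eq (w : ℝ) : ∫ x in Ioi w, stdNormalPDF x = 1 - stdNormalCDF w := by
  rw [stdNormalCDF_eq, ← integral_stdNormalPDF, eq_sub_iff_add_eq, add_comm]
  exact intervalIntegral.integral_Iic_add_Ioi integrable_stdNormalPDF.integrableOn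
    integrable_stdNormalPDF.integrableOn

lemma stdNormalCDF_neg (w : ℝ) : stdNormalCDF (-w) = 1 - stdNormalCDF w := by
  rw [← integral_Ioi_eq, stdNormalCDF_eq]
  have := integral_comp_neg_Ioi w stdNormalPDF
  simp only [stdNormalPDF_neg] at this
  exact this.symm

lemma tendsto_stdNormalPDF_atTop : Tendsto stdNormalPDF atTop (𝓝 0) := by
  have h3 : stdNormalPDF = fun t => (Real.sqrt (2 * Real.pi))⁻¹ * Real.exp (-t ^ 2 / 2) := by
    ext t; exact stdNormalPDF_eq t
  rw [h3, ← mul_zero (Real.sqrt (2 * Real.pi))⁻¹]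
  refine Tendsto.const_mul _ (Real.tendsto_exp_atBot.comp ?_)
  have : Tendsto (fun x : ℝ => x ^ 2 / 2) atTop atTop :=
    (tendsto_pow_atTop two_ne_zero).atTop_div_const two_pos
  refine (tendsto_neg_atTop_atBot.comp this).congr fun x => ?_
  simp [neg_div]

/-- Mills' ratio bound. -/
lemma mul_tail_le {x : ℝ} (hx : 0 ≤ x) : x * (1 - stdNormalCDF x) ≤ stdNormalPDF x := by
  have hd : ∀ t ∈ Ici x, HasDerivAt (fun t => -stdNormalPDF t) (t * stdNormalPDF t) t :=
    fun t _ => by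
      have := (hasDerivAt_stdNormalPDF t).neg
      convert! this using 1
      ring
  have hl : Tendsto (fun t => -stdNormalPDF t) atTop (𝓝 0) := by
    simpa using tendsto_stdNormalPDF_atTop.neg
  have hpos : ∀ t ∈ Ioi x, 0 ≤ t * stdNormalPDF t := fun t ht =>
    mul_nonneg (hx.trans (le_of_lt ht)) (stdNormalPDF_pos t).le
  have h := integral_Ioi_of_hasDerivAt_of_nonneg' hd hpos hl
  have hi := integrableOn_Ioi_deriv_of_nonneg' hd hpos hl
  rw [sub_neg_eq_add, zero_add] at h
  rw [← integral_Ioi_eq, ← h, ← integral_const_mul]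
  refine setIntegral_mono_on (integrable_stdNormalPDF.const_mul x).integrableOn hi
    measurableSet_Ioi fun t ht => ?_
  exact mul_le_mul_of_nonneg_right (le_of_lt ht) (stdNormalPDF_pos t).le

/-- Mills' ratio settles x ≥ 1. On [0,1] the tail is at most 1, while the density is at least
e^{-1/2}/√(2π) > 1/5. -/
lemma tail_le {x : ℝ} (hx : 0 ≤ x) : 1 - stdNormalCDF x ≤ 5 * stdNormalPDF x := by
  rcases le_total 1 x with h | h
  · have h1 := mul_tail_le hx
    have h2 : 0 ≤ 1 - stdNormalCDF x := sub_nonneg.2 (cdf_le_one _ _)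
    nlinarith [stdNormalPDF_pos x]
  · have h2 : 1 - stdNormalCDF x ≤ 1 := by linarith [cdf_nonneg (gaussianReal 0 1) x]
    have h3 : 1 ≤ 5 * stdNormalPDF x := by
      rw [stdNormalPDF_eq]
      have e1 : 1 / 2 ≤ Real.exp (-x ^ 2 / 2) := by
        have := Real.add_one_le_exp (-x ^ 2 / 2)
        nlinarith
      have e2 : Real.sqrt (2 * Real.pi) ≤ 5 / 2 + 1 / 100 := by
        rw [Real.sqrt_le_left (by norm_num)]
        nlinarith [Real.pi_lt_d2]
      have e3 : Real.sqrt (2 * Real.pi) * Real.sqrt (2 * Real.pi) = 2 * Real.pi :=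
        Real.mul_self_sqrt (by positivity)
      have e5 : Real.exp (-1 / 2) ≤ Real.exp (-x ^ 2 / 2) := by
        apply Real.exp_le_exp.2; nlinarith
      have e6 : (6 / 10 : ℝ) ≤ Real.exp (-1 / 2) := by
        have h1 : Real.exp (-1 / 2) * Real.exp (-1 / 2) * Real.exp 1 = 1 := by
          rw [← Real.exp_add, ← Real.exp_add]; norm_num
        have h2 := Real.exp_one_lt_d9
        have h3 := Real.exp_pos (-1 / 2)
        by_contra hc
        push Not at hc
        have : Real.exp (-1 / 2) * Real.exp (-1 / 2) ≤ 36 / 100 := by nlinarith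
        nlinarith [Real.exp_pos 1]
      have hs : 0 < Real.sqrt (2 * Real.pi) := by positivity
      rw [← mul_assoc, mul_comm (5 : ℝ), mul_assoc, inv_mul_eq_div, le_div_iff₀ hs]
      linarith
    linarith

/-- The bounded solution of Stein's equation. -/
lemma exists_stein_solution {h : ℝ → ℝ} (hc : Continuous h) (h0 : ∀ t, 0 ≤ h t)
    (h1 : ∀ t, h t ≤ 1) :
    ∃ f : ℝ → ℝ, (∀ w, HasDerivAt f (w * f w + h w - ∫ t, h t * stdNormalPDF t) w) ∧
      (∀ w, |f w| ≤ 5) ∧ ∀ w, |w * f w| ≤ 1 := by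
  set m := ∫ t, h t * stdNormalPDF t with hm
  have hhi : Integrable fun t => h t * stdNormalPDF t := by
    refine integrable_stdNormalPDF.mono' (hc.mul continuous_stdNormalPDF).aestronglyMeasurable ?_
    refine Eventually.of_forall fun t => ?_
    rw [Real.norm_eq_abs, abs_of_nonneg (mul_nonneg (h0 t) (stdNormalPDF_pos t).le)]
    exact mul_le_of_le_one_left (stdNormalPDF_pos t).le (h1 t)
  have hm0 : 0 ≤ m := integral_nonneg fun t => mul_nonneg (h0 t) (stdNormalPDF_pos t).le
  have hm1 : m ≤ 1 := by
    rw [← integral_stdNormalPDF]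
    exact integral_mono hhi integrable_stdNormalPDF
      fun t => mul_le_of_le_one_left (stdNormalPDF_pos t).le (h1 t)
  set u : ℝ → ℝ := fun t => (h t - m) * stdNormalPDF t with hu
  have hui : Integrable u := by
    have : u = fun t => h t * stdNormalPDF t - m * stdNormalPDF t := by ext t; simp [hu]; ring
    rw [this]
    exact hhi.sub (integrable_stdNormalPDF.const_mul m)
  have huc : Continuous u := (hc.sub continuous_const).mul continuous_stdNormalPDF
  have hu0 : ∫ t, u t = 0 := by
    have : u = fun t => h t * stdNormalPDF t - m * stdNormalPDF t := by ext t; simp [hu]; ring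
    rw [this, integral_sub hhi (integrable_stdNormalPDF.const_mul m), integral_const_mul,
      integral_stdNormalPDF, ← hm]
    ring
  have hub : ∀ t, ‖u t‖ ≤ stdNormalPDF t := fun t => by
    rw [hu]; dsimp only
    rw [Real.norm_eq_abs, abs_mul, abs_of_pos (stdNormalPDF_pos t)]
    refine mul_le_of_le_one_left (stdNormalPDF_pos t).le (abs_le.2 ⟨?_, ?_⟩)
    · linarith [h0 t]
    · linarith [h1 t]
  have hL : ∀ w, |∫ t in Iic w, u t| ≤ stdNormalCDF w := fun w => by
    rw [stdNormalCDF_eq]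
    exact norm_integral_le_of_norm_le integrable_stdNormalPDF.integrableOn
      (Eventually.of_forall hub)
  have hU : ∀ w, |∫ t in Iic w, u t| ≤ 1 - stdNormalCDF w := fun w => by
    have : ∫ t in Iic w, u t = -∫ t in Ioi w, u t := by
      rw [eq_neg_iff_add_eq_zero, ← hu0]
      exact intervalIntegral.integral_Iic_add_Ioi hui.integrableOn hui.integrableOn
    rw [this, abs_neg, ← integral_Ioi_eq]
    exact norm_integral_le_of_norm_le integrable_stdNormalPDF.integrableOn
      (Eventually.of_forall hub)
  -- As u has total integral zero, its antiderivative is controlled from both ends, hence by the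
  -- normal tail beyond |w|. The two bounds on f are then `tail_le` and `mul_tail_le`.
  have hT : ∀ w, |∫ t in Iic w, u t| ≤ 1 - stdNormalCDF |w| := fun w => by
    rcases le_total 0 w with hw | hw
    · rw [abs_of_nonneg hw]; exact hU w
    · rw [abs_of_nonpos hw, ← stdNormalCDF_neg, neg_neg]; exact hL w
  have hpa : ∀ w, stdNormalPDF |w| = stdNormalPDF w := fun w => by
    simp [stdNormalPDF_eq]
  refine ⟨fun w => (∫ t in Iic w, u t) / stdNormalPDF w, fun w => ?_, fun w => ?_, fun w => ?_⟩
  · have hp := (stdNormalPDF_pos w).ne'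
    have := (hasDerivAt_integral_Iic huc hui w).div (hasDerivAt_stdNormalPDF w) hp
    convert! this using 1
    simp only [hu]
    field_simp
    ring
  · rw [abs_div, abs_of_pos (stdNormalPDF_pos w), div_le_iff₀ (stdNormalPDF_pos w)]
    have := tail_le (abs_nonneg w)
    rw [hpa] at this
    exact (hT w).trans this
  · rw [abs_mul, abs_div, abs_of_pos (stdNormalPDF_pos w), ← mul_div_assoc,
      div_le_one (stdNormalPDF_pos w)]
    have := mul_tail_le (abs_nonneg w)
    rw [hpa] at this
    exact (mul_le_mul_of_nonneg_left (hT w) (abs_nonneg w)).trans this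

end Gaussian

/-! ### Expectations under product weights -/

section ProductExpectation

variable {Y : Type*} {N : ℕ}

/-- The sum of the functions `ξ i` of the single letters. -/
def letterSum (ξ : Fin N → Y → ℝ) (y : Fin N → Y) : ℝ := ∑ i, ξ i (y i)

lemma letterSum_update (ξ : Fin N → Y → ℝ) (y : Fin N → Y) (i : Fin N) (b : Y) :
    letterSum ξ (Function.update y i b) = letterSum ξ y - ξ i (y i) + ξ i b := by
  rw [letterSum, letterSum, ← Finset.add_sum_erase Finset.univ _ (Finset.mem_univ i),
    ← Finset.add_sum_erase Finset.univ (fun j => ξ j (y j)) (Finset.mem_univ i),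
    Function.update_self]
  have : ∑ j ∈ Finset.univ.erase i, ξ j (Function.update y i b j) =
      ∑ j ∈ Finset.univ.erase i, ξ j (y j) :=
    Finset.sum_congr rfl fun j hj => by
      rw [Function.update_of_ne (Finset.ne_of_mem_erase hj)]
  rw [this]
  ring

lemma letterSum_neg (ξ : Fin N → Y → ℝ) (y : Fin N → Y) :
    letterSum (fun i b => -ξ i b) y = -letterSum ξ y := by
  simp [letterSum]

lemma letterSum_div (ξ : Fin N → Y → ℝ) (c : ℝ) (y : Fin N → Y) :
    letterSum (fun i b => ξ i b / c) y = letterSum ξ y / c := by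
  simp [letterSum, Finset.sum_div]

lemma letterSum_const_sub (ℓ : Y → ℝ) (a : Fin N → ℝ) (y : Fin N → Y) :
    letterSum (fun _ => ℓ) y = letterSum (fun i b => ℓ b - a i) y + ∑ i, a i := by
  simp [letterSum]

variable [Fintype Y]

/-- The expectation of `F` under the product of the weights `p i`. -/
def prodExp (p : Fin N → Y → ℝ) (F : (Fin N → Y) → ℝ) : ℝ :=
  ∑ y, (∏ i, p i (y i)) * F y

section linear

variable (p : Fin N → Y → ℝ)

lemma prodExp_add (F G : (Fin N → Y) → ℝ) :
    prodExp p (fun y => F y + G y) = prodExp p F + prodExp p G := by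
  simp [prodExp, mul_add, Finset.sum_add_distrib]

lemma prodExp_mul_left (a : ℝ) (F : (Fin N → Y) → ℝ) :
    prodExp p (fun y => a * F y) = a * prodExp p F := by
  simp only [prodExp, Finset.mul_sum]
  exact Finset.sum_congr rfl fun y _ => by ring

lemma prodExp_sub (F G : (Fin N → Y) → ℝ) :
    prodExp p (fun y => F y - G y) = prodExp p F - prodExp p G := by
  simp [prodExp, mul_sub, Finset.sum_sub_distrib]

lemma prodExp_sum {κ : Type*} (s : Finset κ) (F : κ → (Fin N → Y) → ℝ) :
    prodExp p (fun y => ∑ k ∈ s, F k y) = ∑ k ∈ s, prodExp p (F k) := by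
  simp only [prodExp, Finset.mul_sum]
  exact Finset.sum_comm

variable {p}

lemma prodExp_mono (hp : ∀ i b, 0 ≤ p i b) {F G : (Fin N → Y) → ℝ} (h : ∀ y, F y ≤ G y) :
    prodExp p F ≤ prodExp p G :=
  Finset.sum_le_sum fun y _ =>
    mul_le_mul_of_nonneg_left (h y) (Finset.prod_nonneg fun i _ => hp i _)

lemma prodExp_const (hp : ∀ i, ∑ b, p i b = 1) (c : ℝ) : prodExp p (fun _ => c) = c := by
  classical
  rw [prodExp, ← Finset.sum_mul, ← Fintype.prod_sum]
  simp [hp]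

/-- Resampling one coordinate does not change expectations. -/
lemma prodExp_resample (hp : ∀ i, ∑ b, p i b = 1) (i : Fin N) (F : (Fin N → Y) → ℝ) :
    prodExp p F = prodExp p (fun y => ∑ b, p i b * F (Function.update y i b)) := by
  have hl : prodExp p F = ∑ z : (Fin N → Y) × Y, (∏ j, p j (z.1 j)) * p i z.2 * F z.1 := by
    rw [Fintype.sum_prod_type]
    refine Finset.sum_congr rfl fun y _ => ?_
    simp only [mul_assoc, ← Finset.mul_sum, ← Finset.sum_mul, hp, one_mul]
  have hr : prodExp p (fun y => ∑ b, p i b * F (Function.update y i b)) =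
      ∑ z : (Fin N → Y) × Y, (∏ j, p j (z.1 j)) * p i z.2 * F (Function.update z.1 i z.2) := by
    rw [Fintype.sum_prod_type]
    refine Finset.sum_congr rfl fun y _ => ?_
    rw [Finset.mul_sum]
    exact Finset.sum_congr rfl fun b _ => by ring
  -- Exchanging the i-th coordinate with the fresh sample preserves the joint weight.
  have hinv : Function.Involutive fun z : (Fin N → Y) × Y => (Function.update z.1 i z.2, z.1 i) := by
    rintro ⟨y, b⟩
    simp
  rw [hl, hr]
  symm
  refine Fintype.sum_equiv hinv.toPerm _ _ fun ⟨y, b⟩ => ?_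
  simp only [Function.Involutive.coe_toPerm]
  congr 1
  rw [← Finset.mul_prod_erase Finset.univ (fun j => p j (y j)) (Finset.mem_univ i),
    ← Finset.mul_prod_erase Finset.univ (fun j => p j (Function.update y i b j))
      (Finset.mem_univ i), Function.update_self]
  have : ∏ j ∈ Finset.univ.erase i, p j (Function.update y i b j) =
      ∏ j ∈ Finset.univ.erase i, p j (y j) :=
    Finset.prod_congr rfl fun j hj => by
      rw [Function.update_of_ne (Finset.ne_of_mem_erase hj)]
  rw [this]
  ring

end linear

section centered

variable {p ξ : Fin N → Y → ℝ}

/-- The leave-one-out form needed for Stein's method: after resampling, ξ i b is independent of the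
rest of the sum, `letterSum ξ y - ξ i (y i)`. -/
lemma prodExp_letterSum_mul (hp : ∀ i, ∑ b, p i b = 1) (f : ℝ → ℝ) :
    prodExp p (fun y => letterSum ξ y * f (letterSum ξ y)) =
      ∑ i, prodExp p fun y =>
        ∑ b, p i b * (ξ i b * f (letterSum ξ y - ξ i (y i) + ξ i b)) := by
  have h : (fun y => letterSum ξ y * f (letterSum ξ y)) =
      fun y => ∑ i, ξ i (y i) * f (letterSum ξ y) := by
    ext y
    rw [← Finset.sum_mul, letterSum]
  rw [h, prodExp_sum]
  refine Finset.sum_congr rfl fun i _ => ?_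
  rw [prodExp_resample hp i]
  simp only [Function.update_self, letterSum_update]

/-- The variance of a sum of independent centered letters. -/
lemma prodExp_letterSum_sq (hp : ∀ i, ∑ b, p i b = 1) (hξ : ∀ i, ∑ b, p i b * ξ i b = 0) :
    prodExp p (fun y => letterSum ξ y ^ 2) = ∑ i, ∑ b, p i b * ξ i b ^ 2 := by
  have h := prodExp_letterSum_mul (ξ := ξ) hp (fun t => t)
  have h2 : (fun y => letterSum ξ y * letterSum ξ y) = fun y => letterSum ξ y ^ 2 := by
    ext y; ring
  rw [h2] at h
  rw [h]
  refine Finset.sum_congr rfl fun i _ => ?_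
  have : (fun y : Fin N → Y => ∑ b, p i b * (ξ i b * (letterSum ξ y - ξ i (y i) + ξ i b))) =
      fun _ => ∑ b, p i b * ξ i b ^ 2 := by
    ext y
    have : ∀ b, p i b * (ξ i b * (letterSum ξ y - ξ i (y i) + ξ i b)) =
        (letterSum ξ y - ξ i (y i)) * (p i b * ξ i b) + p i b * ξ i b ^ 2 := fun b => by ring
    simp only [this, Finset.sum_add_distrib, ← Finset.mul_sum, hξ, mul_zero, zero_add]
  rw [this, prodExp_const hp]

/-- Chebyshev's inequality. -/
lemma prodExp_le_of_le (hp0 : ∀ i b, 0 ≤ p i b) (hp : ∀ i, ∑ b, p i b = 1)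
    (hξ : ∀ i, ∑ b, p i b * ξ i b = 0) {t : ℝ} (ht : 0 < t) :
    prodExp p (fun y => if t ≤ letterSum ξ y then 1 else 0) ≤
      (∑ i, ∑ b, p i b * ξ i b ^ 2) / t ^ 2 := by
  rw [← prodExp_letterSum_sq hp hξ, div_eq_inv_mul, ← prodExp_mul_left]
  refine prodExp_mono hp0 fun y => ?_
  split_ifs with h
  · rw [← div_eq_inv_mul, one_le_div (by positivity)]
    exact pow_le_pow_left₀ ht.le h 2
  · positivity

end centered

end ProductExpectation

/-! ### Berry-Esseen and concentration bounds for bounded letters -/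

section BerryEsseen

variable {Y : Type*} [Fintype Y] {N : ℕ}

open MeasureTheory

variable {p ξ : Fin N → Y → ℝ}

/-- One-sided smooth comparison with the normal law, by Stein's method. -/
lemma prodExp_smooth_le (hp0 : ∀ i b, 0 ≤ p i b) (hp : ∀ i, ∑ b, p i b = 1)
    (hξ : ∀ i, ∑ b, p i b * ξ i b = 0) {δ : ℝ} (hδ0 : 0 ≤ δ) (hδ : ∀ i b, |ξ i b| ≤ δ)
    (hv : ∑ i, ∑ b, p i b * ξ i b ^ 2 = 1) {h : ℝ → ℝ} (hc : Continuous h) (ha : Antitone h)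
    (h0 : ∀ t, 0 ≤ h t) (h1 : ∀ t, h t ≤ 1) :
    prodExp p (fun y => h (letterSum ξ y + 2 * δ)) ≤
      (∫ t, h t * stdNormalPDF t) + 2 * δ * (7 + 4 * δ) := by
  obtain ⟨f, hf, hf5, hwf⟩ := exists_stein_solution hc h0 h1
  set m := ∫ t, h t * stdNormalPDF t with hm
  have hhi : Integrable fun t => h t * stdNormalPDF t := by
    refine integrable_stdNormalPDF.mono' (hc.mul continuous_stdNormalPDF).aestronglyMeasurable ?_
    refine Filter.Eventually.of_forall fun t => ?_
    rw [Real.norm_eq_abs, abs_of_nonneg (mul_nonneg (h0 t) (stdNormalPDF_pos t).le)]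
    exact mul_le_of_le_one_left (stdNormalPDF_pos t).le (h1 t)
  have hm0 : 0 ≤ m := integral_nonneg fun t => mul_nonneg (h0 t) (stdNormalPDF_pos t).le
  have hm1 : m ≤ 1 := by
    rw [← integral_stdNormalPDF]
    exact integral_mono hhi integrable_stdNormalPDF
      fun t => mul_le_of_le_one_left (stdNormalPDF_pos t).le (h1 t)
  have hf' : ∀ w, |w * f w + h w - m| ≤ 2 := fun w => by
    have e1 := abs_le.1 (hwf w)
    exact abs_le.2 ⟨by linarith [h0 w], by linarith [h1 w]⟩
  have hg : ∀ w, HasDerivAt (fun w => w * f w) (f w + w * (w * f w + h w - m)) w := fun w => by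
    have := (hasDerivAt_id w).mul (hf w)
    convert! this using 1
    simp
  -- The derivative of w f(w) is f + w f', with |f| ≤ 5 and |f'| ≤ 2, so 5 + 2R is a Lipschitz
  -- constant on [-R, R].
  have hglip : ∀ a c r R : ℝ, |c - a| ≤ r → |a| ≤ R → |c| ≤ R →
      a * f a - r * (5 + 2 * R) ≤ c * f c := by
    intro a c r R hr hR hR'
    have hR0 : 0 ≤ R := (abs_nonneg a).trans hR
    have hb := (convex_Icc (-R) R).norm_image_sub_le_of_norm_hasDerivWithin_le
      (f := fun w => w * f w) (C := 5 + 2 * R)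
      (fun x _ => (hg x).hasDerivWithinAt) (fun x hx => by
        rw [Real.norm_eq_abs]
        refine (abs_add_le _ _).trans (add_le_add (hf5 x) ?_)
        rw [abs_mul, mul_comm]
        exact mul_le_mul (hf' x) (abs_le.2 hx) (abs_nonneg _) zero_le_two)
      (abs_le.1 hR) (abs_le.1 hR')
    simp only [Real.norm_eq_abs] at hb
    have hb2 : (5 + 2 * R) * |c - a| ≤ (5 + 2 * R) * r :=
      mul_le_mul_of_nonneg_left hr (by linarith)
    linarith [(abs_le.1 (hb.trans hb2)).1]
  set S := letterSum ξ with hS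
  -- Centering allows f(a) to be subtracted, and the mean value theorem turns ξ(f(a + ξ) - f(a))
  -- into ξ² f'(c) with c within 2δ of S. Stein's equation bounds f'(c) from below. Since h is
  -- antitone, h(c) ≥ h(S + 2δ), so no smoothness of h is needed; this is the reason for the shift.
  have key : ∀ i y, (∑ b, p i b * ξ i b ^ 2) *
      (S y * f (S y) - 2 * δ * (5 + 2 * (|S y| + 2 * δ)) + h (S y + 2 * δ) - m) ≤
      ∑ b, p i b * (ξ i b * f (S y - ξ i (y i) + ξ i b)) := by
    intro i y
    set a := S y - ξ i (y i) with haS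
    set L := S y * f (S y) - 2 * δ * (5 + 2 * (|S y| + 2 * δ)) + h (S y + 2 * δ) - m with hL
    have hcen : ∑ b, p i b * (ξ i b * f (a + ξ i b)) =
        ∑ b, p i b * (ξ i b * (f (a + ξ i b) - f a)) := by
      have : ∀ b, p i b * (ξ i b * (f (a + ξ i b) - f a)) =
          p i b * (ξ i b * f (a + ξ i b)) - f a * (p i b * ξ i b) := fun b => by ring
      simp only [this, Finset.sum_sub_distrib, ← Finset.mul_sum, hξ, mul_zero, sub_zero]
    rw [hcen, Finset.sum_mul]
    refine Finset.sum_le_sum fun b _ => ?_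
    rw [mul_assoc]
    refine mul_le_mul_of_nonneg_left ?_ (hp0 i b)
    have ha1 : |a - S y| ≤ δ := by rw [haS, sub_sub_cancel_left, abs_neg]; exact hδ i _
    have hder : ∀ c, |c - a| ≤ δ → L ≤ c * f c + h c - m := by
      intro c hca
      have h2 : |c - S y| ≤ 2 * δ := by
        have := abs_add_le (c - a) (a - S y)
        rw [sub_add_sub_cancel] at this
        linarith
      have h3 : |c| ≤ |S y| + 2 * δ := by
        have := abs_add_le (c - S y) (S y)
        rw [sub_add_cancel] at this
        linarith
      have h4 := hglip (S y) c (2 * δ) (|S y| + 2 * δ) h2 (by linarith) h3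
      have h5 : h (S y + 2 * δ) ≤ h c := ha (by linarith [(abs_le.1 h2).2])
      rw [hL]
      linarith
    have hx := hδ i b
    rcases lt_trichotomy (ξ i b) 0 with hneg | hz | hpos
    · obtain ⟨c, hcm, hc⟩ := exists_hasDerivAt_eq_slope f (fun w => w * f w + h w - m)
        (show a + ξ i b < a by linarith)
        (fun x _ => (hf x).continuousAt.continuousWithinAt) (fun x _ => hf x)
      have h6 := hder c (by
        rw [abs_of_neg hneg] at hx
        exact abs_le.2 ⟨by linarith [hcm.1], by linarith [hcm.2]⟩)
      rw [hc, le_div_iff₀ (by linarith)] at h6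
      nlinarith
    · simp [hz]
    · obtain ⟨c, hcm, hc⟩ := exists_hasDerivAt_eq_slope f (fun w => w * f w + h w - m)
        (show a < a + ξ i b by linarith)
        (fun x _ => (hf x).continuousAt.continuousWithinAt) (fun x _ => hf x)
      have h6 := hder c (by
        rw [abs_of_pos hpos] at hx
        exact abs_le.2 ⟨by linarith [hcm.1], by linarith [hcm.2]⟩)
      rw [hc, le_div_iff₀ (by linarith)] at h6
      nlinarith
  have hsum := prodExp_letterSum_mul (ξ := ξ) hp f
  rw [← hS] at hsum
  have hle : prodExp p (fun y => S y * f (S y) - 2 * δ * (5 + 2 * (|S y| + 2 * δ)) +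
      h (S y + 2 * δ) - m) ≤ prodExp p (fun y => S y * f (S y)) := by
    rw [hsum]
    have : ∀ F : (Fin N → Y) → ℝ, prodExp p F =
        ∑ i, prodExp p fun y => (∑ b, p i b * ξ i b ^ 2) * F y := fun F => by
      simp only [prodExp_mul_left, ← Finset.sum_mul, hv, one_mul]
    rw [this]
    exact Finset.sum_le_sum fun i _ => prodExp_mono hp0 fun y => key i y
  -- From |S| ≤ (S² + 1)/2 and unit variance; the 7 in the error term is 5 + 2·1.
  have habs : prodExp p (fun y => |S y|) ≤ 1 := by
    have h2 : prodExp p (fun y => |S y|) ≤ prodExp p (fun y => (1 / 2) * S y ^ 2 + 1 / 2) :=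
      prodExp_mono hp0 fun y => by nlinarith [sq_nonneg (|S y| - 1), sq_abs (S y)]
    rw [prodExp_add, prodExp_mul_left, hS, prodExp_letterSum_sq hp hξ, hv, prodExp_const hp] at h2
    linarith
  have hexp : prodExp p (fun y => S y * f (S y) - 2 * δ * (5 + 2 * (|S y| + 2 * δ)) +
      h (S y + 2 * δ) - m) = prodExp p (fun y => S y * f (S y)) -
      2 * δ * (5 + 2 * (prodExp p (fun y => |S y|) + 2 * δ)) +
      prodExp p (fun y => h (S y + 2 * δ)) - m := by
    simp only [prodExp_add, prodExp_sub, prodExp_mul_left, prodExp_const hp]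
  rw [hexp] at hle
  nlinarith

/-- The Berry-Esseen bound for sums of independent bounded letters. -/
lemma prodExp_letterSum_le_normalized (hp0 : ∀ i b, 0 ≤ p i b) (hp : ∀ i, ∑ b, p i b = 1)
    (hξ : ∀ i, ∑ b, p i b * ξ i b = 0) {δ : ℝ} (hδ0 : 0 < δ) (hδ : ∀ i b, |ξ i b| ≤ δ)
    (hv : ∑ i, ∑ b, p i b * ξ i b ^ 2 = 1) (z : ℝ) :
    prodExp p (fun y => if letterSum ξ y ≤ z then 1 else 0) ≤ stdNormalCDF z + 25 * δ := by
  rcases le_total 1 δ with h | hδ1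
  · have h1 : prodExp p (fun y => if letterSum ξ y ≤ z then 1 else 0) ≤
        prodExp p (fun _ => 1) := prodExp_mono hp0 fun y => by split_ifs <;> norm_num
    rw [prodExp_const hp] at h1
    have := ProbabilityTheory.cdf_nonneg (ProbabilityTheory.gaussianReal 0 1) z
    rw [stdNormalCDF]
    linarith
  -- A ramp equal to 1 up to z + 2δ and to 0 from z + 3δ on, so that h(S + 2δ) = 1 whenever S ≤ z.
  -- For δ ≤ 1 the total error is at most 3δ + 2δ(7 + 4δ) ≤ 25δ.
  set h : ℝ → ℝ := fun t => max 0 (min 1 ((z + 3 * δ - t) / δ)) with hh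
  have hc : Continuous h := by fun_prop
  have ha : Antitone h := fun s t hst => by
    simp only [hh]
    gcongr
  have h0 : ∀ t, 0 ≤ h t := fun t => le_max_left _ _
  have h1 : ∀ t, h t ≤ 1 := fun t => max_le zero_le_one (min_le_left _ _)
  have hs := prodExp_smooth_le hp0 hp hξ hδ0.le hδ hv hc ha h0 h1
  have hl : prodExp p (fun y => if letterSum ξ y ≤ z then 1 else 0) ≤
      prodExp p (fun y => h (letterSum ξ y + 2 * δ)) := prodExp_mono hp0 fun y => by
    split_ifs with hy
    · refine le_max_of_le_right (le_min le_rfl ?_)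
      rw [le_div_iff₀ hδ0]
      linarith
    · exact h0 _
  have hi : ∫ t, h t * stdNormalPDF t ≤ stdNormalCDF (z + 3 * δ) := by
    rw [stdNormalCDF_eq, ← integral_indicator measurableSet_Iic]
    refine integral_mono_of_nonneg
      (Filter.Eventually.of_forall fun t => mul_nonneg (h0 t) (stdNormalPDF_pos t).le)
      (integrable_stdNormalPDF.indicator measurableSet_Iic)
      (Filter.Eventually.of_forall fun t => ?_)
    by_cases ht : t ≤ z + 3 * δ
    · simp only [Set.indicator, Set.mem_Iic, ht, if_true]
      exact mul_le_of_le_one_left (stdNormalPDF_pos t).le (h1 t)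
    · have : h t = 0 := by
        refine max_eq_left ((min_le_right _ _).trans ?_)
        exact div_nonpos_of_nonpos_of_nonneg (by linarith) hδ0.le
      simp [Set.indicator, ht, this]
  have hL := stdNormalCDF_sub_le (show z ≤ z + 3 * δ by linarith)
  nlinarith

lemma prodExp_letterSum_le (hp0 : ∀ i b, 0 ≤ p i b) (hp : ∀ i, ∑ b, p i b = 1)
    (hξ : ∀ i, ∑ b, p i b * ξ i b = 0) {B σ : ℝ} (hB0 : 0 < B) (hB : ∀ i b, |ξ i b| ≤ B)
    (hσ : 0 < σ) (hv : ∑ i, ∑ b, p i b * ξ i b ^ 2 = σ ^ 2) (t : ℝ) :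
    prodExp p (fun y => if letterSum ξ y ≤ t then 1 else 0) ≤
      stdNormalCDF (t / σ) + 25 * B / σ := by
  have h := prodExp_letterSum_le_normalized (ξ := fun i b => ξ i b / σ) hp0 hp
    (fun i => by
      have := hξ i
      simp only [← mul_div_assoc, ← Finset.sum_div, this, zero_div])
    (δ := B / σ) (by positivity)
    (fun i b => by rw [abs_div, abs_of_pos hσ]; gcongr; exact hB i b)
    (by
      simp only [div_pow, ← mul_div_assoc, ← Finset.sum_div, hv]
      exact div_self (by positivity)) (t / σ)
  simp only [letterSum_div, div_le_div_iff_of_pos_right hσ] at h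
  rwa [mul_div_assoc]

lemma prodExp_letterSum_ge (hp0 : ∀ i b, 0 ≤ p i b) (hp : ∀ i, ∑ b, p i b = 1)
    (hξ : ∀ i, ∑ b, p i b * ξ i b = 0) {B σ : ℝ} (hB0 : 0 < B) (hB : ∀ i b, |ξ i b| ≤ B)
    (hσ : 0 < σ) (hv : ∑ i, ∑ b, p i b * ξ i b ^ 2 = σ ^ 2) (t : ℝ) :
    prodExp p (fun y => if t ≤ letterSum ξ y then 1 else 0) ≤
      1 - stdNormalCDF (t / σ) + 25 * B / σ := by
  have h := prodExp_letterSum_le (ξ := fun i b => -ξ i b) hp0 hp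
    (fun i => by simp [hξ i]) hB0 (fun i b => by rw [abs_neg]; exact hB i b) hσ
    (by simpa using hv) (-t)
  simp only [letterSum_neg, neg_le_neg_iff, neg_div, stdNormalCDF_neg] at h
  exact h

/-- Concentration of a sum of independent bounded letters on intervals. -/
lemma prodExp_letterSum_mem_le (hp0 : ∀ i b, 0 ≤ p i b) (hp : ∀ i, ∑ b, p i b = 1)
    (hξ : ∀ i, ∑ b, p i b * ξ i b = 0) {B σ : ℝ} (hB0 : 0 < B) (hB : ∀ i b, |ξ i b| ≤ B)
    (hσ : 0 < σ) (hv : ∑ i, ∑ b, p i b * ξ i b ^ 2 = σ ^ 2) {s t : ℝ} (hst : s ≤ t) :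
    prodExp p (fun y => if s ≤ letterSum ξ y ∧ letterSum ξ y ≤ t then 1 else 0) ≤
      (t - s + 50 * B) / σ := by
  have h1 := prodExp_letterSum_le hp0 hp hξ hB0 hB hσ hv t
  have h2 := prodExp_letterSum_ge hp0 hp hξ hB0 hB hσ hv s
  have h3 : prodExp p (fun y => if s ≤ letterSum ξ y ∧ letterSum ξ y ≤ t then 1 else 0) ≤
      prodExp p (fun y => (if letterSum ξ y ≤ t then 1 else 0) +
        (if s ≤ letterSum ξ y then 1 else 0) - 1) := prodExp_mono hp0 fun y => by
    by_cases h : s ≤ letterSum ξ y <;> by_cases h' : letterSum ξ y ≤ t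
    · simp [h, h']
    · simp [h, h']
    · simp [h, h']
    · exact absurd (hst.trans (not_le.1 h').le) h
  rw [prodExp_sub, prodExp_add, prodExp_const hp] at h3
  have h4 := stdNormalCDF_sub_le (div_le_div_of_nonneg_right hst hσ.le)
  have h5 : (t - s + 50 * B) / σ = t / σ - s / σ + 25 * B / σ + 25 * B / σ := by ring
  linarith

/-- On the k-th unit slab below 0 the exponential is at most e^{-k}. Each slab will cost one
interval probability of order 1/σ, and the geometric weights keep the total at that order. -/
lemma exp_indicator_le {u : ℝ} {K : ℕ} (hK : -u < K) :
    (if u < 0 then Real.exp u else 0) ≤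
      ∑ k ∈ Finset.range K, Real.exp (-(k : ℝ)) *
        (if -((k : ℝ) + 1) ≤ u ∧ u ≤ -(k : ℝ) then 1 else 0) := by
  have hn : ∀ k ∈ Finset.range K, 0 ≤ Real.exp (-(k : ℝ)) *
        (if -((k : ℝ) + 1) ≤ u ∧ u ≤ -(k : ℝ) then (1 : ℝ) else 0) := fun k _ => by
    split_ifs <;> positivity
  split_ifs with hu
  · have h1 := Nat.floor_le (show 0 ≤ -u by linarith)
    have h2 := Nat.lt_floor_add_one (-u)
    refine le_trans ?_ (Finset.single_le_sum hn (Finset.mem_range.2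
      ((Nat.floor_lt (by linarith)).2 hK)))
    rw [if_pos ⟨by linarith, by linarith⟩, mul_one]
    exact Real.exp_le_exp.2 (by linarith)
  · exact Finset.sum_nonneg hn

lemma sum_exp_neg_le (K : ℕ) : ∑ k ∈ Finset.range K, Real.exp (-(k : ℝ)) ≤ 2 := by
  have h : ∀ k : ℕ, Real.exp (-(k : ℝ)) ≤ (1 / 2) ^ k := fun k => by
    have : Real.exp (-1) ≤ 1 / 2 := by
      rw [Real.exp_neg, one_div]
      exact inv_anti₀ two_pos (by linarith [Real.add_one_le_exp 1])
    rw [← mul_neg_one, Real.exp_nat_mul]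
    exact pow_le_pow_left₀ (Real.exp_pos _).le this k
  refine (Finset.sum_le_sum fun k _ => h k).trans ?_
  have := geom_sum_eq (show (1 / 2 : ℝ) ≠ 1 by norm_num) K
  rw [this]
  have : (0 : ℝ) ≤ (1 / 2) ^ K := by positivity
  rw [div_le_iff_of_neg (by norm_num)]
  linarith

/-- The exponential moment below a threshold is of the order of the concentration function. -/
lemma prodExp_exp_below_le (hp0 : ∀ i b, 0 ≤ p i b) (hp : ∀ i, ∑ b, p i b = 1)
    (hξ : ∀ i, ∑ b, p i b * ξ i b = 0) {B σ : ℝ} (hB0 : 0 < B) (hB : ∀ i b, |ξ i b| ≤ B)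
    (hσ : 0 < σ) (hv : ∑ i, ∑ b, p i b * ξ i b ^ 2 = σ ^ 2) (t : ℝ) :
    prodExp p (fun y => if letterSum ξ y < t then Real.exp (letterSum ξ y - t) else 0) ≤
      2 * (1 + 50 * B) / σ := by
  obtain ⟨K, hK⟩ : ∃ K : ℕ, ∀ y, -(letterSum ξ y - t) < K := by
    obtain ⟨K, hK⟩ := exists_nat_gt (∑ y : Fin N → Y, |-(letterSum ξ y - t)|)
    refine ⟨K, fun y => (le_abs_self _).trans_lt (lt_of_le_of_lt ?_ hK)⟩
    exact Finset.single_le_sum (f := fun y : Fin N → Y => |-(letterSum ξ y - t)|)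
      (fun y _ => abs_nonneg _) (Finset.mem_univ y)
  have h1 := prodExp_mono hp0 fun y => exp_indicator_le (hK y)
  simp only [prodExp_sum, prodExp_mul_left, sub_neg] at h1
  refine h1.trans ?_
  have h2 : ∀ k ∈ Finset.range K, Real.exp (-(k : ℝ)) * prodExp p (fun y =>
      if -((k : ℝ) + 1) ≤ letterSum ξ y - t ∧ letterSum ξ y - t ≤ -(k : ℝ) then 1 else 0) ≤
      Real.exp (-(k : ℝ)) * ((1 + 50 * B) / σ) := fun k _ => by
    refine mul_le_mul_of_nonneg_left ?_ (Real.exp_pos _).le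
    have h3 := prodExp_letterSum_mem_le hp0 hp hξ hB0 hB hσ hv
      (show t - (k + 1) ≤ t - (k : ℝ) by linarith)
    have h4 : t - (k : ℝ) - (t - (k + 1)) = 1 := by ring
    rw [h4] at h3
    refine le_trans (prodExp_mono hp0 fun y => ?_) h3
    refine le_of_eq (if_congr ?_ rfl rfl)
    constructor <;> rintro ⟨h5, h6⟩ <;> constructor <;> linarith
  refine (Finset.sum_le_sum h2).trans ?_
  rw [← Finset.sum_mul, mul_div_assoc]
  exact mul_le_mul_of_nonneg_right (sum_exp_neg_le K) (by positivity)

end BerryEsseen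

/-! ### The converse for a density that depends on the output only -/

section Converse

variable {X Y : Type*} [Fintype Y] {N M : ℕ}

lemma avgError_nonneg {W : X → Y → ℝ} (hW : IsChannel W) (c : Code X Y N M) : 0 ≤ avgError W c :=
  mul_nonneg (by positivity) <| Finset.sum_nonneg fun _ _ => Finset.sum_nonneg fun _ _ =>
    Finset.prod_nonneg fun _ _ => (hW _).1 _

lemma one_sub_avgError_eq {W : X → Y → ℝ} (hW : IsChannel W) (c : Code X Y N M) (hM : 0 < M) :
    1 - avgError W c = (1 / (M : ℝ)) * ∑ y : Fin N → Y, wordProb W (c.enc (c.dec y)) y := by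
  have hM' : (M : ℝ) ≠ 0 := by positivity
  have h1 : ∀ m : Fin M, ∑ y : Fin N → Y, wordProb W (c.enc m) y = 1 := fun m => by
    have := prodExp_const (p := fun i => W (c.enc m i)) (fun i => (hW _).2) 1
    simpa [prodExp, wordProb] using this
  have h2 : ∑ y : Fin N → Y, wordProb W (c.enc (c.dec y)) y =
      ∑ m : Fin M, ∑ y : Fin N → Y with c.dec y = m, wordProb W (c.enc m) y := by
    rw [← Finset.sum_fiberwise Finset.univ c.dec]
    refine Finset.sum_congr rfl fun m _ => Finset.sum_congr rfl fun y hy => ?_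
    rw [(Finset.mem_filter.1 hy).2]
  have h3 : ∀ m : Fin M, ∑ y : Fin N → Y with c.dec y ≠ m, wordProb W (c.enc m) y =
      1 - ∑ y : Fin N → Y with c.dec y = m, wordProb W (c.enc m) y := fun m => by
    rw [← h1 m, eq_sub_iff_add_eq, add_comm]
    exact Finset.sum_filter_add_sum_filter_not _ _ _
  rw [avgError, h2]
  simp only [h3, Finset.sum_sub_distrib, Finset.sum_const, Finset.card_univ, Fintype.card_fin,
    nsmul_eq_mul, mul_one]
  field_simp
  ring

/-- The information-spectrum converse: the probability of correct decoding is at most the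
probability that the information density exceeds the threshold `t` plus the truncated exponential
moment of the information density under the output measure. -/
lemma one_sub_avgError_le {W : X → Y → ℝ} (hW : IsChannel W) (c : Code X Y N M) (hM : 0 < M)
    {q ℓ : Y → ℝ} (hq : ∀ m i y, W (c.enc m i) y ≤ q y * Real.exp (ℓ y)) (t : ℝ) :
    1 - avgError W c ≤
      (1 / (M : ℝ)) * ∑ m : Fin M, prodExp (fun i => W (c.enc m i))
        (fun y => if t ≤ letterSum (fun _ => ℓ) y then 1 else 0) +
      (1 / (M : ℝ)) * prodExp (fun _ => q)
        (fun y : Fin N → Y => if letterSum (fun _ => ℓ) y < t then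
          Real.exp (letterSum (fun _ => ℓ) y) else 0) := by
  rw [one_sub_avgError_eq hW c hM, ← mul_add]
  refine mul_le_mul_of_nonneg_left ?_ (by positivity)
  simp only [prodExp]
  rw [Finset.sum_comm, ← Finset.sum_add_distrib]
  refine Finset.sum_le_sum fun y _ => ?_
  have hw0 : ∀ m, 0 ≤ wordProb W (c.enc m) y := fun m =>
    Finset.prod_nonneg fun i _ => (hW _).1 _
  -- Above the threshold the decoded word's likelihood is one summand of the sum over messages.
  -- Below it, the dominating product of q e^ℓ no longer involves the codeword, so no sum over
  -- messages is paid.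
  by_cases h : t ≤ letterSum (fun _ => ℓ) y
  · simp only [h, if_true, mul_one, not_lt.2 h, if_false, mul_zero, add_zero]
    exact Finset.single_le_sum (f := fun m => wordProb W (c.enc m) y) (fun m _ => hw0 m)
      (Finset.mem_univ (c.dec y))
  · simp only [h, if_false, mul_zero, Finset.sum_const_zero, zero_add, not_le.1 h, if_true]
    rw [letterSum, Real.exp_sum, ← Finset.prod_mul_distrib]
    exact Finset.prod_le_prod (fun i _ => (hW _).1 _) fun i _ => hq _ i (y i)

/-- The conditional mean of `ℓ` given the input letter `x`. -/
def condMean (W : X → Y → ℝ) (ℓ : Y → ℝ) (x : X) : ℝ := ∑ b, W x b * ℓ b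

lemma sum_mul_sub_sq_eq {W : X → Y → ℝ} (hW : IsChannel W) (ℓ : Y → ℝ) (x : X) (a : ℝ) :
    ∑ y, W x y * (ℓ y - a) ^ 2 =
      ∑ y, W x y * (ℓ y - condMean W ℓ x) ^ 2 + (condMean W ℓ x - a) ^ 2 := by
  have h1 : ∑ y, W x y = 1 := (hW x).2
  have h2 : ∑ y, W x y * ℓ y = condMean W ℓ x := rfl
  have h3 : ∀ a, ∑ y, W x y * (ℓ y - a) ^ 2 =
      ∑ y, W x y * ℓ y ^ 2 - 2 * a * condMean W ℓ x + a ^ 2 := fun a => by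
    have : ∀ y, W x y * (ℓ y - a) ^ 2 =
        W x y * ℓ y ^ 2 - 2 * a * (W x y * ℓ y) + a ^ 2 * W x y := fun y => by ring
    simp only [this, Finset.sum_add_distrib, Finset.sum_sub_distrib, ← Finset.mul_sum, h1, h2,
      mul_one]
  rw [h3, h3]
  ring

lemma condMean_nonneg (hW : IsChannel W) {ℓ : Y → ℝ} (hℓ : ∀ y, 0 ≤ ℓ y) (x : X) :
    0 ≤ condMean W ℓ x :=
  Finset.sum_nonneg fun y _ => mul_nonneg ((hW x).1 y) (hℓ y)

lemma abs_sum_mul_le {p : Y → ℝ} (hp : p ∈ stdSimplex ℝ Y) {ℓ : Y → ℝ} {B : ℝ}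
    (hB : ∀ y, |ℓ y| ≤ B) : |∑ y, p y * ℓ y| ≤ B := by
  refine (Finset.abs_sum_le_sum_abs _ _).trans ?_
  calc ∑ y, |p y * ℓ y| ≤ ∑ y, p y * B := Finset.sum_le_sum fun y _ => by
        rw [abs_mul, abs_of_nonneg (hp.1 y)]
        exact mul_le_mul_of_nonneg_left (hB y) (hp.1 y)
    _ = B := by rw [← Finset.sum_mul, hp.2, one_mul]

lemma empiricalDist_pos (hN : 0 < N) (x : Fin N → X) (i : Fin N) : 0 < empiricalDist x (x i) :=
  div_pos (Nat.cast_pos.2 (Finset.card_pos.2 ⟨i, by simp⟩)) (Nat.cast_pos.2 hN)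

variable [Fintype X]

/-- The mean of `ℓ` under the output distribution. -/
def avgMean (P : X → ℝ) (W : X → Y → ℝ) (ℓ : Y → ℝ) : ℝ := ∑ x, P x * condMean W ℓ x

/-- The average conditional variance of `ℓ`. -/
def avgVar (P : X → ℝ) (W : X → Y → ℝ) (ℓ : Y → ℝ) : ℝ :=
  ∑ x, P x * ∑ y, W x y * (ℓ y - condMean W ℓ x) ^ 2

lemma sum_outputDist_mul (P : X → ℝ) (W : X → Y → ℝ) (φ : Y → ℝ) :
    ∑ y, outputDist P W y * φ y = ∑ x, P x * ∑ y, W x y * φ y := by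
  simp only [outputDist, Finset.sum_mul, Finset.mul_sum]
  rw [Finset.sum_comm]
  exact Finset.sum_congr rfl fun x _ => Finset.sum_congr rfl fun y _ => by ring

lemma outputDist_nonneg {P : X → ℝ} {W : X → Y → ℝ} (hW : IsChannel W)
    (hP : P ∈ stdSimplex ℝ X) (y : Y) : 0 ≤ outputDist P W y :=
  Finset.sum_nonneg fun x _ => mul_nonneg (hP.1 x) ((hW x).1 y)

lemma sum_outputDist {P : X → ℝ} {W : X → Y → ℝ} (hW : IsChannel W)
    (hP : P ∈ stdSimplex ℝ X) : ∑ y, outputDist P W y = 1 := by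
  have h := sum_outputDist_mul P W (fun _ => 1)
  have h2 : ∀ x, ∑ y, W x y = 1 := fun x => (hW x).2
  have h3 : ∑ x, P x = 1 := hP.2
  simpa [h2, h3] using h

lemma avgVar_nonneg {P : X → ℝ} {W : X → Y → ℝ} (hW : IsChannel W)
    (hP : P ∈ stdSimplex ℝ X) (ℓ : Y → ℝ) : 0 ≤ avgVar P W ℓ :=
  Finset.sum_nonneg fun x _ => mul_nonneg (hP.1 x) <| Finset.sum_nonneg fun y _ =>
    mul_nonneg ((hW x).1 y) (sq_nonneg _)

/-- The average conditional variance is at most the second moment about any point. -/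
lemma avgVar_le {P : X → ℝ} {W : X → Y → ℝ} (hW : IsChannel W)
    (hP : P ∈ stdSimplex ℝ X) (ℓ : Y → ℝ) (a : ℝ) :
    avgVar P W ℓ ≤ ∑ y, outputDist P W y * (ℓ y - a) ^ 2 := by
  rw [sum_outputDist_mul]
  refine Finset.sum_le_sum fun x _ => mul_le_mul_of_nonneg_left ?_ (hP.1 x)
  rw [sum_mul_sub_sq_eq hW ℓ x a]
  linarith [sq_nonneg (condMean W ℓ x - a)]

/-- Group the positions by letter. Through this, all codewords of composition P give the density sum
the same mean and the same variance. -/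
lemma sum_letters_eq (hN : 0 < N) (x : Fin N → X) (φ : X → ℝ) :
    ∑ i, φ (x i) = N * ∑ a, empiricalDist x a * φ a := by
  classical
  have hN' : (N : ℝ) ≠ 0 := by positivity
  rw [← Finset.sum_fiberwise Finset.univ x, Finset.mul_sum]
  refine Finset.sum_congr rfl fun a _ => ?_
  have : ∑ i with x i = a, φ (x i) = ∑ i with x i = a, φ a :=
    Finset.sum_congr rfl fun i hi => by rw [(Finset.mem_filter.1 hi).2]
  rw [this, Finset.sum_const, nsmul_eq_mul, empiricalDist]
  field_simp

lemma empiricalDist_mem (hN : 0 < N) (x : Fin N → X) : empiricalDist x ∈ stdSimplex ℝ X := by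
  refine ⟨fun a => by unfold empiricalDist; positivity, ?_⟩
  have h := sum_letters_eq hN x (fun _ => 1)
  simp only [Finset.sum_const, Finset.card_univ, Fintype.card_fin, nsmul_eq_mul, mul_one] at h
  have hN' : (N : ℝ) ≠ 0 := by positivity
  exact (mul_left_cancel₀ hN' (by rw [mul_one]; exact h)).symm

variable {W : X → Y → ℝ} {P : X → ℝ} {ℓ : Y → ℝ} {ε : ℝ}

/-- The bound on the code size from Chebyshev's inequality. -/
lemma log_card_le_chebyshev (hW : IsChannel W) (c : Code X Y N M) (hM : 0 < M) (hN : 0 < N)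
    (hc : ∀ m, empiricalDist (c.enc m) = P) (hP : P ∈ stdSimplex ℝ X)
    (hℓ : ∀ x, 0 < P x → ∀ y, W x y ≤ outputDist P W y * Real.exp (ℓ y))
    (hε : ε < 1) (he : avgError W c ≤ ε) :
    Real.log M ≤ N * avgMean P W ℓ + Real.sqrt (N * avgVar P W ℓ * (2 / (1 - ε))) +
      Real.log (2 / (1 - ε)) := by
  set I := avgMean P W ℓ with hI
  set V := avgVar P W ℓ with hV
  have hV0 : 0 ≤ V := avgVar_nonneg hW hP ℓ
  have hε' : 0 < 1 - ε := by linarith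
  have hM' : (0 : ℝ) < M := by positivity
  have hN' : (0 : ℝ) < N := by positivity
  have hdom : ∀ m i y, W (c.enc m i) y ≤ outputDist P W y * Real.exp (ℓ y) := fun m i y =>
    hℓ _ (by rw [← hc m]; exact empiricalDist_pos hN _ i) y
  refine le_of_forall_pos_le_add fun η hη => ?_
  -- Chosen so that Chebyshev leaves at most (1 - ε)/2 above the threshold; the slack η keeps s
  -- positive when V = 0.
  set s := Real.sqrt (N * V * (2 / (1 - ε))) + η with hs
  have hs0 : 0 < s := by positivity
  have hconv := one_sub_avgError_le hW c hM hdom (N * I + s)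
  have h1 : ∀ m, prodExp (fun i => W (c.enc m i))
        (fun y => if N * I + s ≤ letterSum (fun _ => ℓ) y then 1 else 0) ≤ (1 - ε) / 2 := by
    intro m
    have hmean : ∑ i, condMean W ℓ (c.enc m i) = N * I := by
      rw [sum_letters_eq hN, hc m, hI, avgMean]
    have hcheb := prodExp_le_of_le (p := fun i => W (c.enc m i))
      (ξ := fun i b => ℓ b - condMean W ℓ (c.enc m i)) (fun i b => (hW _).1 b)
      (fun i => (hW _).2) (fun i => by
        have : ∑ b, W (c.enc m i) b = 1 := (hW _).2
        simp only [mul_sub, Finset.sum_sub_distrib, ← Finset.sum_mul, this, one_mul, condMean,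
          sub_self]) hs0
    have hvar : ∑ i, ∑ b, W (c.enc m i) b * (ℓ b - condMean W ℓ (c.enc m i)) ^ 2 = N * V := by
      rw [sum_letters_eq hN _ (fun x => ∑ b, W x b * (ℓ b - condMean W ℓ x) ^ 2), hc m, hV, avgVar]
    rw [hvar] at hcheb
    have heq : (fun y : Fin N → Y => if N * I + s ≤ letterSum (fun _ => ℓ) y then (1 : ℝ) else 0) =
        fun y => if s ≤ letterSum (fun i b => ℓ b - condMean W ℓ (c.enc m i)) y then 1 else 0 := by
      ext y
      refine if_congr ?_ rfl rfl
      rw [letterSum_const_sub ℓ (fun i => condMean W ℓ (c.enc m i)) y, hmean]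
      constructor <;> intro h <;> linarith
    rw [heq]
    refine hcheb.trans ?_
    rw [div_le_iff₀ (by positivity)]
    have h2 : N * V * (2 / (1 - ε)) ≤ s ^ 2 := by
      rw [← Real.sq_sqrt (show 0 ≤ N * V * (2 / (1 - ε)) by positivity)]
      exact pow_le_pow_left₀ (Real.sqrt_nonneg _) (by rw [hs]; linarith) 2
    calc N * V = (1 - ε) / 2 * (N * V * (2 / (1 - ε))) := by field_simp
      _ ≤ (1 - ε) / 2 * s ^ 2 := mul_le_mul_of_nonneg_left h2 (by positivity)
  have h2 : prodExp (fun _ => outputDist P W) (fun y : Fin N → Y =>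
      if letterSum (fun _ => ℓ) y < N * I + s then Real.exp (letterSum (fun _ => ℓ) y) else 0) ≤
      Real.exp (N * I + s) := by
    refine (prodExp_mono (fun _ b => outputDist_nonneg hW hP b)
      (G := fun _ => Real.exp (N * I + s)) fun y => ?_).trans
      (prodExp_const (fun _ => sum_outputDist hW hP) _).le
    split_ifs with h
    · exact Real.exp_le_exp.2 h.le
    · positivity
  have h3 : (1 / (M : ℝ)) * ∑ m : Fin M, prodExp (fun i => W (c.enc m i))
        (fun y => if N * I + s ≤ letterSum (fun _ => ℓ) y then 1 else 0) ≤ (1 - ε) / 2 := by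
    rw [one_div, inv_mul_le_iff₀ hM']
    refine (Finset.sum_le_sum fun m _ => h1 m).trans ?_
    simp
  have h4 : (1 - ε) / 2 ≤ 1 / (M : ℝ) * Real.exp (N * I + s) := by
    have := mul_le_mul_of_nonneg_left h2 (show 0 ≤ 1 / (M : ℝ) by positivity)
    linarith
  have h5 : (M : ℝ) ≤ 2 / (1 - ε) * Real.exp (N * I + s) := by
    rw [one_div, inv_mul_eq_div, le_div_iff₀ hM'] at h4
    rw [div_mul_eq_mul_div, le_div_iff₀ hε']
    linarith
  have h6 := Real.log_le_log hM' h5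
  rw [Real.log_mul (by positivity) (by positivity), Real.log_exp] at h6
  linarith

/-- The bound on the code size from the normal approximation, without a logarithmic term. -/
lemma stdNormalCDF_log_card_le (hW : IsChannel W) (c : Code X Y N M) (hM : 0 < M) (hN : 0 < N)
    (hc : ∀ m, empiricalDist (c.enc m) = P) (hP : P ∈ stdSimplex ℝ X)
    (hℓ : ∀ x, 0 < P x → ∀ y, W x y ≤ outputDist P W y * Real.exp (ℓ y))
    {B : ℝ} (hB0 : 0 < B) (hB : ∀ y, |ℓ y| ≤ B) (hV : 0 < avgVar P W ℓ)
    (he : avgError W c ≤ ε) :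
    stdNormalCDF ((Real.log M - N * avgMean P W ℓ) / Real.sqrt (N * avgVar P W ℓ)) ≤
      ε + (2 + 250 * B) / Real.sqrt (N * avgVar P W ℓ) := by
  set I := avgMean P W ℓ with hI
  set V := avgVar P W ℓ with hVdef
  have hM' : (0 : ℝ) < M := by positivity
  have hN' : (0 : ℝ) < N := by positivity
  have hdom : ∀ m i y, W (c.enc m i) y ≤ outputDist P W y * Real.exp (ℓ y) := fun m i y =>
    hℓ _ (by rw [← hc m]; exact empiricalDist_pos hN _ i) y
  -- With the threshold ln M, the factor 1/M turns e^S into e^{S - ln M} ≤ 1.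
  have hconv := one_sub_avgError_le hW c hM hdom (Real.log M)
  set σ := Real.sqrt (N * V) with hσ
  have hσ0 : 0 < σ := Real.sqrt_pos.2 (by positivity)
  have hσ2 : σ ^ 2 = N * V := Real.sq_sqrt (by positivity)
  have h1 : ∀ m, prodExp (fun i => W (c.enc m i))
        (fun y => if Real.log M ≤ letterSum (fun _ => ℓ) y then 1 else 0) ≤
      1 - stdNormalCDF ((Real.log M - N * I) / σ) + 25 * (2 * B) / σ := by
    intro m
    have hmean : ∑ i, condMean W ℓ (c.enc m i) = N * I := by
      rw [sum_letters_eq hN, hc m, hI, avgMean]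
    have hvar : ∑ i, ∑ b, W (c.enc m i) b * (ℓ b - condMean W ℓ (c.enc m i)) ^ 2 = σ ^ 2 := by
      rw [hσ2, sum_letters_eq hN _ (fun x => ∑ b, W x b * (ℓ b - condMean W ℓ x) ^ 2), hc m,
        hVdef, avgVar]
    have hbe := prodExp_letterSum_ge (p := fun i => W (c.enc m i))
      (ξ := fun i b => ℓ b - condMean W ℓ (c.enc m i)) (fun i b => (hW _).1 b)
      (fun i => (hW _).2) (fun i => by
        have : ∑ b, W (c.enc m i) b = 1 := (hW _).2
        simp only [mul_sub, Finset.sum_sub_distrib, ← Finset.sum_mul, this, one_mul, condMean,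
          sub_self]) (show 0 < 2 * B by positivity)
      (fun i b => (abs_sub _ _).trans (by
        have := abs_sum_mul_le (hW (c.enc m i)) hB
        have h2 := hB b
        rw [condMean]
        linarith)) hσ0 hvar (Real.log M - N * I)
    refine le_trans (prodExp_mono (fun i b => (hW _).1 b) fun y => le_of_eq ?_) hbe
    refine if_congr ?_ rfl rfl
    rw [letterSum_const_sub ℓ (fun i => condMean W ℓ (c.enc m i)) y, hmean]
    constructor <;> intro h <;> linarith
  have h3 : (1 / (M : ℝ)) * ∑ m : Fin M, prodExp (fun i => W (c.enc m i))
        (fun y => if Real.log M ≤ letterSum (fun _ => ℓ) y then 1 else 0) ≤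
      1 - stdNormalCDF ((Real.log M - N * I) / σ) + 25 * (2 * B) / σ := by
    rw [one_div, inv_mul_le_iff₀ hM']
    refine (Finset.sum_le_sum fun m _ => h1 m).trans (le_of_eq ?_)
    rw [Finset.sum_const, Finset.card_univ, Fintype.card_fin, nsmul_eq_mul]
  have hq : outputDist P W ∈ stdSimplex ℝ Y :=
    ⟨fun y => outputDist_nonneg hW hP y, sum_outputDist hW hP⟩
  have hIq : ∑ y, outputDist P W y * ℓ y = I := sum_outputDist_mul P W ℓ
  -- The variance under the output law also counts the variation of the conditional means, so U ≥ V
  -- and the truncated moment is of order at most 1/√(NV).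
  set U := ∑ y, outputDist P W y * (ℓ y - I) ^ 2 with hU
  have hUV : V ≤ U := avgVar_le hW hP ℓ I
  have hU0 : 0 < U := hV.trans_le hUV
  set τ := Real.sqrt (N * U) with hτ
  have hτ0 : 0 < τ := Real.sqrt_pos.2 (by positivity)
  have hτ2 : τ ^ 2 = N * U := Real.sq_sqrt (by positivity)
  have hστ : σ ≤ τ := Real.sqrt_le_sqrt (by gcongr)
  have h2 : (1 / (M : ℝ)) * prodExp (fun _ => outputDist P W) (fun y : Fin N → Y =>
      if letterSum (fun _ => ℓ) y < Real.log M then Real.exp (letterSum (fun _ => ℓ) y) else 0) ≤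
      2 * (1 + 50 * (2 * B)) / τ := by
    have hb := prodExp_exp_below_le (N := N) (p := fun _ => outputDist P W)
      (ξ := fun _ b => ℓ b - I) (fun _ b => hq.1 b) (fun _ => hq.2) (fun _ => by
        have : ∑ b, outputDist P W b = 1 := hq.2
        simp only [mul_sub, Finset.sum_sub_distrib, ← Finset.sum_mul, this, one_mul, hIq,
          sub_self]) (show 0 < 2 * B by positivity)
      (fun i b => (abs_sub _ _).trans (by
        have := abs_sum_mul_le hq hB
        rw [hIq] at this
        have h2 := hB b
        linarith)) hτ0 (by simp [hτ2, hU]) (Real.log M - N * I)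
    rw [← prodExp_mul_left]
    refine le_trans (prodExp_mono (fun _ b => hq.1 b) fun y => le_of_eq ?_) hb
    have hS : letterSum (fun _ => ℓ) y = letterSum (fun _ b => ℓ b - I) y + N * I := by
      rw [letterSum_const_sub ℓ (fun _ => I) y]
      simp
    have hiff : letterSum (fun _ => ℓ) y < Real.log M ↔
        letterSum (fun _ b => ℓ b - I) y < Real.log M - N * I := by
      rw [hS]
      constructor <;> intro h <;> linarith
    rw [mul_ite, mul_zero]
    refine if_congr hiff ?_ rfl
    have hsub : letterSum (fun _ b => ℓ b - I) y - (Real.log M - N * I) =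
        letterSum (fun _ => ℓ) y - Real.log M := by rw [hS]; ring
    rw [hsub, Real.exp_sub, Real.exp_log hM']
    ring
  have h5 : 2 * (1 + 50 * (2 * B)) / τ ≤ 2 * (1 + 50 * (2 * B)) / σ :=
    div_le_div_of_nonneg_left (by positivity) hσ0 hστ
  have h6 : (2 + 250 * B) / σ = 25 * (2 * B) / σ + 2 * (1 + 50 * (2 * B)) / σ := by ring
  linarith

end Converse

/-! ### Singular channels: capacity gap and common dispersion -/

section Singular

variable {X Y : Type*} [Fintype X]

/-- The largest entry of the column `y`; in a singular channel, the common value of its positive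
entries. -/
def colValue [Nonempty X] (W : X → Y → ℝ) (y : Y) : ℝ :=
  Finset.univ.sup' Finset.univ_nonempty fun x => W x y

/-- The `P`-probability that the input letter can produce `y`. -/
def reach (P : X → ℝ) (W : X → Y → ℝ) (y : Y) : ℝ :=
  ∑ x, P x * if 0 < W x y then 1 else 0

/-- The information density of a singular channel, a function of the output letter. -/
def infoDens (P : X → ℝ) (W : X → Y → ℝ) (y : Y) : ℝ := -Real.log (reach P W y)

lemma reach_nonneg {P : X → ℝ} (hP : P ∈ stdSimplex ℝ X) (W : X → Y → ℝ) (y : Y) :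
    0 ≤ reach P W y :=
  Finset.sum_nonneg fun x _ => mul_nonneg (hP.1 x) (by split_ifs <;> norm_num)

lemma reach_le_one {P : X → ℝ} (hP : P ∈ stdSimplex ℝ X) (W : X → Y → ℝ) (y : Y) :
    reach P W y ≤ 1 := by
  rw [← hP.2]
  exact Finset.sum_le_sum fun x _ =>
    mul_le_of_le_one_right (hP.1 x) (by split_ifs <;> norm_num)

lemma infoDens_nonneg {P : X → ℝ} (hP : P ∈ stdSimplex ℝ X) (W : X → Y → ℝ) (y : Y) :
    0 ≤ infoDens P W y :=
  neg_nonneg.2 (Real.log_nonpos (reach_nonneg hP W y) (reach_le_one hP W y))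

lemma reach_pos {P : X → ℝ} (hP : P ∈ stdSimplex ℝ X) {W : X → Y → ℝ} {x : X} {y : Y}
    (hx : 0 < P x) (hy : 0 < W x y) : 0 < reach P W y := by
  refine lt_of_lt_of_le ?_ (Finset.single_le_sum
    (f := fun x => P x * if 0 < W x y then (1 : ℝ) else 0)
    (fun z _ => mul_nonneg (hP.1 z) (by split_ifs <;> norm_num)) (Finset.mem_univ x))
  simpa [hy] using hx

lemma reach_mix (P Q : X → ℝ) (W : X → Y → ℝ) (t : ℝ) (y : Y) :
    reach (fun x => (1 - t) * P x + t * Q x) W y = (1 - t) * reach P W y + t * reach Q W y := by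
  simp only [reach, add_mul, Finset.sum_add_distrib, mul_assoc, ← Finset.mul_sum]

lemma mix_mem {P Q : X → ℝ} (hP : P ∈ stdSimplex ℝ X) (hQ : Q ∈ stdSimplex ℝ X) {t : ℝ}
    (h0 : 0 ≤ t) (h1 : t ≤ 1) : (fun x => (1 - t) * P x + t * Q x) ∈ stdSimplex ℝ X :=
  convex_stdSimplex ℝ X hP hQ (sub_nonneg.2 h1) h0 (by ring)

/-- The density -ln r is unbounded as r tends to 0, but its weighted square is not. This bounds V(P)
uniformly over all P. -/
lemma neg_mul_log_sq_le {r : ℝ} (h0 : 0 ≤ r) (h1 : r ≤ 1) : r * Real.log r ^ 2 ≤ 4 := by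
  have hs := Real.sqrt_nonneg r
  have hs1 : Real.sqrt r ≤ 1 := Real.sqrt_le_one.2 h1
  have h2 := Real.negMulLog_nonneg hs hs1
  have h3 := Real.negMulLog_le_one_sub_self hs
  have h4 : r * Real.log r ^ 2 = 4 * Real.negMulLog (Real.sqrt r) ^ 2 := by
    rw [Real.negMulLog, Real.log_sqrt h0]
    nth_rewrite 1 [← Real.sq_sqrt h0]
    ring
  rw [h4]
  nlinarith

/-- A quadratic strengthening of the tangent inequality for `negMulLog` on `[0,1]`. -/
lemma negMulLog_le_tangent {r a : ℝ} (hr0 : 0 ≤ r) (hr1 : r ≤ 1) (ha0 : 0 < a) (ha1 : a ≤ 1) :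
    Real.negMulLog r ≤ -r * Real.log a - (r - a) - (r - a) ^ 2 / 4 := by
  have hx := Real.sqrt_nonneg r
  have hy := Real.sqrt_pos.2 ha0
  have hx2 := Real.sq_sqrt hr0
  have hy2 := Real.sq_sqrt ha0.le
  have hx1 : Real.sqrt r ≤ 1 := Real.sqrt_le_one.2 hr1
  have hy1 : Real.sqrt a ≤ 1 := Real.sqrt_le_one.2 ha1
  set x := Real.sqrt r
  set y := Real.sqrt a
  -- The inequality ln t ≤ t - 1 at t = √a/√r. The added terms equal -(r - a) - (√r - √a)², and (√r
  -- - √a)² ≥ (r - a)²/4 because √r + √a ≤ 2.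
  have h1 : Real.negMulLog r ≤ -r * Real.log a + 2 * x * y - 2 * x ^ 2 := by
    rcases hx.eq_or_lt with h | h
    · have : r = 0 := by rw [← hx2, ← h]; norm_num
      simp [this, ← h]
    · have hl := Real.log_le_sub_one_of_pos (div_pos hy h)
      rw [Real.log_div hy.ne' h.ne'] at hl
      have e1 : Real.log r = 2 * Real.log x := by rw [← hx2, Real.log_pow]; norm_num
      have e2 : Real.log a = 2 * Real.log y := by rw [← hy2, Real.log_pow]; norm_num
      rw [Real.negMulLog, e1, e2, ← hx2]
      have h2 := mul_le_mul_of_nonneg_left hl (show 0 ≤ 2 * x ^ 2 by positivity)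
      have h3 : 2 * x ^ 2 * (y / x - 1) = 2 * x * y - 2 * x ^ 2 := by field_simp
      linarith
  have h2 : (r - a) ^ 2 / 4 ≤ (x - y) ^ 2 := by
    have : r - a = (x - y) * (x + y) := by rw [← hx2, ← hy2]; ring
    rw [this, mul_pow]
    have h3 : (x + y) ^ 2 ≤ 4 := by nlinarith
    nlinarith [sq_nonneg (x - y)]
  nlinarith

section

variable [Nonempty X] {W : X → Y → ℝ}

lemma exists_pos_of_colValue_pos {y : Y} (h : 0 < colValue W y) : ∃ x, 0 < W x y := by
  obtain ⟨z, -, hz⟩ := Finset.exists_mem_eq_sup' (Finset.univ_nonempty (α := X)) fun x => W x y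
  exact ⟨z, by rw [← hz]; exact h⟩

lemma reach_eq_zero (P : X → ℝ) {y : Y} (h : colValue W y ≤ 0) : reach P W y = 0 := by
  refine Finset.sum_eq_zero fun x _ => ?_
  have : W x y ≤ colValue W y := Finset.le_sup' (fun x => W x y) (Finset.mem_univ x)
  simp [not_lt.2 (this.trans h)]

end

variable [Fintype Y] {W : X → Y → ℝ}

/-- The law of total variance, with second moments taken about an arbitrary point a. -/
lemma avgVar_eq_sub (hW : IsChannel W) (P : X → ℝ) (ℓ : Y → ℝ) (a : ℝ) :
    avgVar P W ℓ = ∑ y, outputDist P W y * (ℓ y - a) ^ 2 -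
      ∑ x, P x * (a - condMean W ℓ x) ^ 2 := by
  rw [sum_outputDist_mul]
  simp only [sum_mul_sub_sq_eq hW ℓ _ a, mul_add, Finset.sum_add_distrib, avgVar]
  simp only [← neg_sub a, neg_sq]
  simp

variable {Q : X → ℝ}

/-- The linear part of the capacity gap of `P`, relative to the optimal distribution `Q`. -/
def linearGap (Q : X → ℝ) (W : X → Y → ℝ) (P : X → ℝ) : ℝ :=
  ∑ x, P x * (capacity W - condMean W (infoDens Q W) x)

lemma linearGap_le_capacity (hW : IsChannel W) (hQ : Q ∈ optimalInputs W)
    {P : X → ℝ} (hP : P ∈ stdSimplex ℝ X) : linearGap Q W P ≤ capacity W := by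
  have h : linearGap Q W P ≤ ∑ x, P x * capacity W := Finset.sum_le_sum fun x _ =>
    mul_le_mul_of_nonneg_left
      (sub_le_self _ (condMean_nonneg hW (infoDens_nonneg hQ.1 W) x)) (hP.1 x)
  rwa [← Finset.sum_mul, hP.2, one_mul] at h

variable [Nonempty X]

/-- The factorization through which singularity enters: by it W/q_P does not depend on the input
letter. -/
lemma eq_colValue_mul (hW : IsChannel W) (hs : IsSingular W) (x : X) (y : Y) :
    W x y = colValue W y * if 0 < W x y then 1 else 0 := by
  split_ifs with h
  · rw [mul_one]
    obtain ⟨z, -, hz⟩ := Finset.exists_mem_eq_sup' (Finset.univ_nonempty (α := X))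
      fun x => W x y
    have hz' : colValue W y = W z y := hz
    have hle : W x y ≤ colValue W y :=
      Finset.le_sup' (fun x => W x y) (Finset.mem_univ x)
    rw [hz'] at hle ⊢
    exact hs x y z (mul_pos h (h.trans_le hle))
  · rw [mul_zero]
    exact le_antisymm (not_lt.1 h) ((hW x).1 y)

lemma colValue_nonneg (hW : IsChannel W) (y : Y) : 0 ≤ colValue W y :=
  ((hW (Classical.arbitrary X)).1 y).trans
    (Finset.le_sup' (fun x => W x y) (Finset.mem_univ _))

lemma outputDist_eq (hW : IsChannel W) (hs : IsSingular W) (P : X → ℝ) (y : Y) :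
    outputDist P W y = colValue W y * reach P W y := by
  rw [outputDist, reach, Finset.mul_sum]
  refine Finset.sum_congr rfl fun x _ => ?_
  rw [mul_left_comm, ← eq_colValue_mul hW hs x y]

lemma sum_colValue_mul_reach (hW : IsChannel W) (hs : IsSingular W) {P : X → ℝ}
    (hP : P ∈ stdSimplex ℝ X) : ∑ y, colValue W y * reach P W y = 1 := by
  simp only [← outputDist_eq hW hs]
  exact sum_outputDist hW hP

lemma mul_log_eq (hW : IsChannel W) (hs : IsSingular W) (P : X → ℝ) (x : X) (y : Y) :
    W x y * Real.log (W x y / outputDist P W y) = W x y * infoDens P W y := by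
  rcases ((hW x).1 y).eq_or_lt with h | h
  · rw [← h, zero_mul, zero_mul]
  · have h1 := eq_colValue_mul hW hs x y
    rw [if_pos h, mul_one] at h1
    rw [outputDist_eq hW hs, ← h1, div_mul_cancel_left₀ h.ne', Real.log_inv, infoDens]

lemma mutualInfo_eq_avgMean (hW : IsChannel W) (hs : IsSingular W) (P : X → ℝ) :
    mutualInfo P W = avgMean P W (infoDens P W) := by
  simp only [mutualInfo, avgMean, condMean, Finset.mul_sum, mul_assoc, mul_log_eq hW hs]

lemma dispersion_eq_avgVar (hW : IsChannel W) (hs : IsSingular W) (P : X → ℝ) :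
    dispersion P W = avgVar P W (infoDens P W) := by
  simp only [dispersion, avgVar, condMean, Finset.mul_sum, mul_log_eq hW hs]
  refine Finset.sum_congr rfl fun x _ => Finset.sum_congr rfl fun y _ => ?_
  rcases ((hW x).1 y).eq_or_lt with h | h
  · simp [← h]
  · have := mul_left_cancel₀ h.ne' (mul_log_eq hW hs P x y)
    rw [this, mul_assoc]

lemma mutualInfo_eq_sum (hW : IsChannel W) (hs : IsSingular W) (P : X → ℝ) :
    mutualInfo P W = ∑ y, colValue W y * Real.negMulLog (reach P W y) := by
  rw [mutualInfo_eq_avgMean hW hs, avgMean]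
  simp only [condMean]
  rw [← sum_outputDist_mul]
  refine Finset.sum_congr rfl fun y _ => ?_
  rw [outputDist_eq hW hs, infoDens, Real.negMulLog]
  ring

/-- An equality where W x y > 0; this is the domination hypothesis of the converse. Positivity of P
x keeps `reach P W y` nonzero there. -/
lemma le_outputDist_mul_exp (hW : IsChannel W) (hs : IsSingular W) {P : X → ℝ}
    (hP : P ∈ stdSimplex ℝ X) (x : X) (hx : 0 < P x) (y : Y) :
    W x y ≤ outputDist P W y * Real.exp (infoDens P W y) := by
  rcases ((hW x).1 y).eq_or_lt with h | h
  · rw [← h]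
    exact mul_nonneg (outputDist_nonneg hW hP y) (Real.exp_pos _).le
  · have hr := reach_pos hP hx h
    have h1 := eq_colValue_mul hW hs x y
    rw [if_pos h, mul_one] at h1
    rw [outputDist_eq hW hs, ← h1, infoDens, Real.exp_neg, Real.exp_log hr, mul_assoc,
      mul_inv_cancel₀ hr.ne', mul_one]

lemma continuous_mutualInfo (hW : IsChannel W) (hs : IsSingular W) :
    Continuous fun P => mutualInfo P W := by
  simp only [mutualInfo_eq_sum hW hs, reach]
  refine continuous_finsetSum _ fun y _ => continuous_const.mul ?_
  exact Real.continuous_negMulLog.comp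
    (continuous_finsetSum _ fun x _ => (continuous_apply x).mul continuous_const)

lemma bddAbove_mutualInfo (hW : IsChannel W) (hs : IsSingular W) :
    BddAbove ((fun P => mutualInfo P W) '' stdSimplex ℝ X) :=
  ((isCompact_stdSimplex ℝ X).image (continuous_mutualInfo hW hs)).bddAbove

lemma mutualInfo_le_capacity (hW : IsChannel W) (hs : IsSingular W) {P : X → ℝ}
    (hP : P ∈ stdSimplex ℝ X) : mutualInfo P W ≤ capacity W :=
  le_csSup (bddAbove_mutualInfo hW hs) ⟨P, hP, rfl⟩

lemma exists_mem_optimalInputs (hW : IsChannel W) (hs : IsSingular W) :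
    ∃ P, P ∈ optimalInputs W := by
  classical
  have hne : (stdSimplex ℝ X).Nonempty := ⟨_, single_mem_stdSimplex ℝ (Classical.arbitrary X)⟩
  have hc := (isCompact_stdSimplex ℝ X).image (continuous_mutualInfo hW hs)
  obtain ⟨P, hP, h⟩ := hc.sSup_mem (hne.image _)
  exact ⟨P, hP, h⟩

/-- An optimal output distribution charges every output letter that can occur. -/
lemma reach_pos_of_optimal (hW : IsChannel W) (hs : IsSingular W) (hQ : Q ∈ optimalInputs W)
    {y : Y} (hy : 0 < colValue W y) : 0 < reach Q W y := by
  classical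
  by_contra hcon
  have h0 : reach Q W y = 0 := le_antisymm (not_lt.1 hcon) (reach_nonneg hQ.1 W y)
  obtain ⟨x, hx⟩ := exists_pos_of_colValue_pos hy
  set P : X → ℝ := Pi.single x 1 with hPdef
  have hP : P ∈ stdSimplex ℝ X := single_mem_stdSimplex ℝ x
  have hr : reach P W y = 1 := by
    rw [reach, Finset.sum_eq_single x (fun z _ hz => by simp [hPdef, hz]) (by simp)]
    simp [hPdef, hx]
  -- Moving mass t to x gains w(y)·(-t ln t) in column y. This t makes the gain t(|C| + w(y)), which
  -- exceeds the loss tC.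
  set t := Real.exp (-(|capacity W| / colValue W y + 1)) with ht
  have ht0 : 0 < t := Real.exp_pos _
  have ht1 : t ≤ 1 := Real.exp_le_one_iff.2 (by
    have : 0 ≤ |capacity W| / colValue W y := by positivity
    linarith)
  have hle := mutualInfo_le_capacity hW hs (mix_mem hQ.1 hP ht0.le ht1)
  have hQc := hQ.2
  rw [mutualInfo_eq_sum hW hs] at hle hQc
  simp only [reach_mix] at hle
  have hterm : ∀ z, 0 ≤ colValue W z * (Real.negMulLog ((1 - t) * reach Q W z + t * reach P W z) -
      (1 - t) * Real.negMulLog (reach Q W z)) := fun z => by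
    refine mul_nonneg (colValue_nonneg hW z) ?_
    have h1 := Real.concaveOn_negMulLog.2 (x := reach Q W z) (reach_nonneg hQ.1 W z)
      (y := reach P W z) (reach_nonneg hP W z) (sub_nonneg.2 ht1) ht0.le (by ring)
    have h2 := Real.negMulLog_nonneg (reach_nonneg hP W z) (reach_le_one hP W z)
    simp only [smul_eq_mul] at h1
    nlinarith
  have h1 := Finset.single_le_sum (f := fun z => colValue W z *
    (Real.negMulLog ((1 - t) * reach Q W z + t * reach P W z) -
      (1 - t) * Real.negMulLog (reach Q W z))) (fun z _ => hterm z) (Finset.mem_univ y)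
  have h2 : ∑ z, colValue W z * (Real.negMulLog ((1 - t) * reach Q W z + t * reach P W z) -
      (1 - t) * Real.negMulLog (reach Q W z)) ≤ t * capacity W := by
    have : ∀ z, colValue W z * (Real.negMulLog ((1 - t) * reach Q W z + t * reach P W z) -
      (1 - t) * Real.negMulLog (reach Q W z)) =
      colValue W z * Real.negMulLog ((1 - t) * reach Q W z + t * reach P W z) -
      (1 - t) * (colValue W z * Real.negMulLog (reach Q W z)) := fun z => by ring
    simp only [this, Finset.sum_sub_distrib, ← Finset.mul_sum, hQc]
    linarith
  have h3 := h1.trans h2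
  simp only [h0, hr, mul_zero, zero_add, mul_one, Real.negMulLog_zero, sub_zero] at h3
  rw [Real.negMulLog, ht, Real.log_exp, ← ht] at h3
  have h4 : colValue W y * (-t * -(|capacity W| / colValue W y + 1)) =
      t * (|capacity W| + colValue W y) := by field_simp
  rw [h4] at h3
  have h5 := le_of_mul_le_mul_left h3 ht0
  linarith [le_abs_self (capacity W)]

/-- The Kuhn-Tucker condition for an optimal input distribution. -/
lemma sum_mul_infoDens_le (hW : IsChannel W) (hs : IsSingular W) (hQ : Q ∈ optimalInputs W)
    {P : X → ℝ} (hP : P ∈ stdSimplex ℝ X) :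
    ∑ y, colValue W y * reach P W y * infoDens Q W y ≤ capacity W := by
  set w := colValue W
  set a := reach Q W with ha
  set r := reach P W with hr
  set K := ∑ y, w y * r y * infoDens Q W y with hK
  set E := ∑ y, w y * ((r y - a y) ^ 2 / a y) with hE
  have hE0 : 0 ≤ E := Finset.sum_nonneg fun y _ => mul_nonneg (colValue_nonneg hW y)
    (div_nonneg (sq_nonneg _) (reach_nonneg hQ.1 W y))
  -- Optimality against (1 - t)Q + tP: the first-order gain t(K - C) cannot exceed the second-order
  -- term t²E, where E is a χ²-distance. Then t tends to 0.
  have key : ∀ t : ℝ, 0 < t → t ≤ 1 → K - capacity W ≤ t * E := by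
    intro t ht0 ht1
    have hle := mutualInfo_le_capacity hW hs (mix_mem hQ.1 hP ht0.le ht1)
    have hQc := hQ.2
    rw [mutualInfo_eq_sum hW hs] at hle hQc
    simp only [reach_mix] at hle
    have hy : ∀ y, (1 - t) * (w y * Real.negMulLog (a y)) + t * (w y * r y * infoDens Q W y) -
        t * (w y * r y - w y * a y) - t ^ 2 * (w y * ((r y - a y) ^ 2 / a y)) ≤
        w y * Real.negMulLog ((1 - t) * a y + t * r y) := by
      intro y
      rcases (colValue_nonneg hW y).eq_or_lt with h | h
      · simp [w, ← h]
      · have ha0 : 0 < a y := reach_pos_of_optimal hW hs hQ h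
        have hr0 : 0 ≤ r y := reach_nonneg hP W y
        have hb0 : 0 ≤ (1 - t) * a y + t * r y :=
          add_nonneg (mul_nonneg (sub_nonneg.2 ht1) ha0.le) (mul_nonneg ht0.le hr0)
        set b := (1 - t) * a y + t * r y with hb
        have hlog : -b * Real.log (a y) - b * ((b - a y) / a y) ≤ Real.negMulLog b := by
          rcases hb0.eq_or_lt with hz | hz
          · simp [← hz]
          · have := Real.log_le_sub_one_of_pos (div_pos hz ha0)
            rw [Real.log_div hz.ne' ha0.ne'] at this
            have h2 : b / a y - 1 = (b - a y) / a y := by field_simp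
            rw [h2] at this
            rw [Real.negMulLog]
            have := mul_le_mul_of_nonneg_left this hz.le
            linarith
        have heq : (1 - t) * (w y * Real.negMulLog (a y)) + t * (w y * r y * infoDens Q W y) -
            t * (w y * r y - w y * a y) - t ^ 2 * (w y * ((r y - a y) ^ 2 / a y)) =
            w y * (-b * Real.log (a y) - b * ((b - a y) / a y)) := by
          rw [hb, Real.negMulLog, infoDens, ← ha]
          field_simp
          ring
        rw [heq]
        exact mul_le_mul_of_nonneg_left hlog h.le
    have hsum := Finset.sum_le_sum fun y (_ : y ∈ Finset.univ) => hy y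
    simp only [Finset.sum_sub_distrib, Finset.sum_add_distrib, ← Finset.mul_sum] at hsum
    rw [hQc, ← hK, ← hE, sum_colValue_mul_reach hW hs hQ.1, sum_colValue_mul_reach hW hs hP]
      at hsum
    have h3 : t * (K - capacity W) ≤ t * (t * E) := by nlinarith
    exact le_of_mul_le_mul_left h3 ht0
  refine le_of_forall_pos_le_add fun η hη => ?_
  have h1 := key (min 1 (η / (E + 1))) (by positivity) (min_le_left _ _)
  have h2 : min 1 (η / (E + 1)) * E ≤ η := by
    refine (mul_le_mul_of_nonneg_right (min_le_right _ _) hE0).trans ?_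
    rw [div_mul_eq_mul_div, div_le_iff₀ (by positivity)]
    nlinarith
  linarith

/-- The distance of the output distributions of `P` and `Q`, weighted by the channel. -/
def reachDist (Q : X → ℝ) (W : X → Y → ℝ) (P : X → ℝ) : ℝ :=
  Real.sqrt (∑ y, colValue W y * (reach P W y - reach Q W y) ^ 2)

lemma condMean_infoDens_le (hW : IsChannel W) (hs : IsSingular W) (hQ : Q ∈ optimalInputs W)
    (x : X) : condMean W (infoDens Q W) x ≤ capacity W := by
  classical
  have hP : (Pi.single x 1 : X → ℝ) ∈ stdSimplex ℝ X := single_mem_stdSimplex ℝ x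
  have h := sum_mul_infoDens_le hW hs hQ hP
  simp only [← outputDist_eq hW hs] at h
  refine le_trans (le_of_eq ?_) h
  rw [sum_outputDist_mul]
  simp [condMean, Pi.single_apply]

lemma linearGap_nonneg (hW : IsChannel W) (hs : IsSingular W) (hQ : Q ∈ optimalInputs W)
    {P : X → ℝ} (hP : P ∈ stdSimplex ℝ X) : 0 ≤ linearGap Q W P :=
  Finset.sum_nonneg fun x _ =>
    mul_nonneg (hP.1 x) (sub_nonneg.2 (condMean_infoDens_le hW hs hQ x))

lemma linearGap_eq (hW : IsChannel W) (hs : IsSingular W) {P : X → ℝ}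
    (hP : P ∈ stdSimplex ℝ X) : linearGap Q W P =
      capacity W - ∑ y, colValue W y * reach P W y * infoDens Q W y := by
  simp only [← outputDist_eq hW hs]
  rw [sum_outputDist_mul, linearGap]
  simp only [mul_sub, Finset.sum_sub_distrib, ← Finset.sum_mul]
  have : ∑ x, P x = 1 := hP.2
  rw [this, one_mul]
  rfl

lemma capacity_nonneg (hW : IsChannel W) (hs : IsSingular W) (hQ : Q ∈ optimalInputs W) :
    0 ≤ capacity W :=
  (condMean_nonneg hW (infoDens_nonneg hQ.1 W) (Classical.arbitrary X)).trans
    (condMean_infoDens_le hW hs hQ _)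

lemma sum_sq_nonneg (hW : IsChannel W) (P : X → ℝ) :
    0 ≤ ∑ y, colValue W y * (reach P W y - reach Q W y) ^ 2 :=
  Finset.sum_nonneg fun y _ => mul_nonneg (colValue_nonneg hW y) (sq_nonneg _)

/-- The mutual information falls short of capacity by a linear and a quadratic term. -/
lemma mutualInfo_le_sub (hW : IsChannel W) (hs : IsSingular W) (hQ : Q ∈ optimalInputs W)
    {P : X → ℝ} (hP : P ∈ stdSimplex ℝ X) :
    mutualInfo P W ≤ capacity W - linearGap Q W P - reachDist Q W P ^ 2 / 4 := by
  rw [linearGap_eq hW hs hP, reachDist, Real.sq_sqrt (sum_sq_nonneg hW P),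
    mutualInfo_eq_sum hW hs]
  -- The tangent inequality at r_Q; its linear terms cancel in the sum, since both output laws have
  -- total mass 1.
  have hy : ∀ y, colValue W y * Real.negMulLog (reach P W y) ≤
      colValue W y * reach P W y * infoDens Q W y -
      (colValue W y * reach P W y - colValue W y * reach Q W y) -
      (1 / 4) * (colValue W y * (reach P W y - reach Q W y) ^ 2) := fun y => by
    rcases (colValue_nonneg hW y).eq_or_lt with h | h
    · simp [← h]
    · have := negMulLog_le_tangent (reach_nonneg hP W y) (reach_le_one hP W y)
        (reach_pos_of_optimal hW hs hQ h) (reach_le_one hQ.1 W y)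
      have := mul_le_mul_of_nonneg_left this h.le
      rw [infoDens]
      linarith
  have hsum := Finset.sum_le_sum fun y (_ : y ∈ Finset.univ) => hy y
  simp only [Finset.sum_sub_distrib, ← Finset.mul_sum] at hsum
  rw [sum_colValue_mul_reach hW hs hQ.1, sum_colValue_mul_reach hW hs hP] at hsum
  linarith

lemma linearGap_eq_zero (hW : IsChannel W) (hs : IsSingular W) (hQ : Q ∈ optimalInputs W)
    {P : X → ℝ} (hP : P ∈ optimalInputs W) : linearGap Q W P = 0 := by
  have h1 := mutualInfo_le_sub hW hs hQ hP.1
  rw [hP.2] at h1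
  have h2 := linearGap_nonneg hW hs hQ hP.1
  nlinarith [sq_nonneg (reachDist Q W P)]

lemma reach_eq_of_optimal (hW : IsChannel W) (hs : IsSingular W) (hQ : Q ∈ optimalInputs W)
    {P : X → ℝ} (hP : P ∈ optimalInputs W) : reach P W = reach Q W := by
  have h1 := mutualInfo_le_sub hW hs hQ hP.1
  rw [hP.2] at h1
  have h2 := linearGap_nonneg hW hs hQ hP.1
  have h3 : reachDist Q W P ^ 2 = 0 := le_antisymm (by linarith) (sq_nonneg _)
  rw [reachDist, Real.sq_sqrt (sum_sq_nonneg hW P), Finset.sum_eq_zero_iff_of_nonneg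
    fun y _ => mul_nonneg (colValue_nonneg hW y) (sq_nonneg _)] at h3
  ext y
  rcases (colValue_nonneg hW y).eq_or_lt with h | h
  · rw [reach_eq_zero P h.ge, reach_eq_zero Q h.ge]
  · have := h3 y (Finset.mem_univ y)
    rw [mul_eq_zero, or_iff_right h.ne', sq_eq_zero_iff, sub_eq_zero] at this
    exact this

/-- A zero gap confines P to letters whose conditional mean is C, so the between-letter part of the
variance vanishes. What is left depends on P only through `reach`, which all optimal inputs share.
-/
lemma dispersion_of_optimal (hW : IsChannel W) (hs : IsSingular W) (hQ : Q ∈ optimalInputs W)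
    {P : X → ℝ} (hP : P ∈ optimalInputs W) : dispersion P W =
      ∑ y, colValue W y * reach Q W y * (infoDens Q W y - capacity W) ^ 2 := by
  have hr := reach_eq_of_optimal hW hs hQ hP
  have hi : infoDens P W = infoDens Q W := by ext y; rw [infoDens, infoDens, hr]
  rw [dispersion_eq_avgVar hW hs, hi, avgVar_eq_sub hW P _ (capacity W)]
  simp only [outputDist_eq hW hs, hr]
  have h0 := linearGap_eq_zero hW hs hQ hP
  rw [linearGap, Finset.sum_eq_zero_iff_of_nonneg fun x _ =>
    mul_nonneg (hP.1.1 x) (sub_nonneg.2 (condMean_infoDens_le hW hs hQ x))] at h0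
  rw [sub_eq_self]
  refine Finset.sum_eq_zero fun x hx => ?_
  rw [sq, ← mul_assoc, h0 x hx, zero_mul]

/-- In a singular channel all optimal input distributions have the same dispersion. -/
lemma epsDispersion_eq (hW : IsChannel W) (hs : IsSingular W) (hQ : Q ∈ optimalInputs W) (ε : ℝ) :
    epsDispersion ε W =
      ∑ y, colValue W y * reach Q W y * (infoDens Q W y - capacity W) ^ 2 := by
  have h : (fun P => dispersion P W) '' optimalInputs W =
      {∑ y, colValue W y * reach Q W y * (infoDens Q W y - capacity W) ^ 2} := by
    ext v
    constructor
    · rintro ⟨P, hP, rfl⟩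
      exact dispersion_of_optimal hW hs hQ hP
    · rintro rfl
      exact ⟨Q, hQ, dispersion_of_optimal hW hs hQ hQ⟩
  rw [epsDispersion, h]
  simp

end Singular

/-! ### Stability of the dispersion near the optimal inputs -/

section Perturbation

variable {X Y : Type*} [Fintype X] [Fintype Y]

lemma abs_avgVar_sub_le {P : X → ℝ} {W : X → Y → ℝ} (hW : IsChannel W)
    (hP : P ∈ stdSimplex ℝ X) {ℓ ℓ' : Y → ℝ} {B η : ℝ} (hB : ∀ y, |ℓ y| ≤ B)
    (hB' : ∀ y, |ℓ' y| ≤ B) (hη : ∀ y, |ℓ y - ℓ' y| ≤ η) :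
    |avgVar P W ℓ - avgVar P W ℓ'| ≤ 8 * B * η := by
  have hx : ∀ x, |∑ y, W x y * (ℓ y - condMean W ℓ x) ^ 2 -
      ∑ y, W x y * (ℓ' y - condMean W ℓ' x) ^ 2| ≤ 8 * B * η := fun x => by
    rw [← Finset.sum_sub_distrib]
    simp only [← mul_sub]
    refine abs_sum_mul_le (hW x) fun y => ?_
    have hm : |condMean W ℓ x - condMean W ℓ' x| ≤ η := by
      rw [condMean, condMean, ← Finset.sum_sub_distrib]
      simp only [← mul_sub]
      exact abs_sum_mul_le (hW x) hη
    have h1 := abs_sum_mul_le (hW x) hB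
    have h2 := abs_sum_mul_le (hW x) hB'
    have h3 : (ℓ y - condMean W ℓ x) ^ 2 - (ℓ' y - condMean W ℓ' x) ^ 2 =
        ((ℓ y - condMean W ℓ x) + (ℓ' y - condMean W ℓ' x)) *
        ((ℓ y - ℓ' y) - (condMean W ℓ x - condMean W ℓ' x)) := by ring
    have h4 : |(ℓ y - condMean W ℓ x) + (ℓ' y - condMean W ℓ' x)| ≤ 4 * B := by
      refine (abs_add_le _ _).trans ?_
      have e1 := abs_sub (ℓ y) (condMean W ℓ x)
      have e2 := abs_sub (ℓ' y) (condMean W ℓ' x)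
      have e3 := hB y
      have e4 := hB' y
      rw [← condMean] at h1 h2
      linarith
    have h5 : |(ℓ y - ℓ' y) - (condMean W ℓ x - condMean W ℓ' x)| ≤ 2 * η :=
      (abs_sub _ _).trans (by linarith [hη y])
    rw [h3, abs_mul]
    calc _ ≤ (4 * B) * (2 * η) :=
          mul_le_mul h4 h5 (abs_nonneg _) ((abs_nonneg _).trans h4)
      _ = 8 * B * η := by ring
  rw [avgVar, avgVar, ← Finset.sum_sub_distrib]
  simp only [← mul_sub]
  exact abs_sum_mul_le hP hx

variable [Nonempty X] {W : X → Y → ℝ} {Q : X → ℝ}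

lemma exists_reach_lower_bound (hW : IsChannel W) (hs : IsSingular W) (hQ : Q ∈ optimalInputs W) :
    ∃ a₀ : ℝ, 0 < a₀ ∧ a₀ ≤ 1 ∧ ∀ y, 0 < colValue W y → a₀ ≤ reach Q W y := by
  have hn : ∀ y, 0 ≤ (reach Q W y)⁻¹ := fun y => inv_nonneg.2 (reach_nonneg hQ.1 W y)
  have h0 : 0 ≤ ∑ y, (reach Q W y)⁻¹ := Finset.sum_nonneg fun y _ => hn y
  refine ⟨(1 + ∑ y, (reach Q W y)⁻¹)⁻¹, by positivity, inv_le_one_of_one_le₀ (by linarith),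
    fun y hy => ?_⟩
  rw [inv_le_comm₀ (by positivity) (reach_pos_of_optimal hW hs hQ hy)]
  have := Finset.single_le_sum (fun z _ => hn z) (Finset.mem_univ y)
  linarith

lemma exists_abs_reach_sub_le (hW : IsChannel W) (Q : X → ℝ) :
    ∃ κ : ℝ, 0 < κ ∧ ∀ (P : X → ℝ) (y : Y), |reach P W y - reach Q W y| ≤ κ * reachDist Q W P := by
  have hn : ∀ y, 0 ≤ (Real.sqrt (colValue W y))⁻¹ := fun y => inv_nonneg.2 (Real.sqrt_nonneg _)
  have h0 : 0 ≤ ∑ y, (Real.sqrt (colValue W y))⁻¹ := Finset.sum_nonneg fun y _ => hn y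
  refine ⟨1 + ∑ y, (Real.sqrt (colValue W y))⁻¹, by positivity, fun P y => ?_⟩
  have hR : 0 ≤ reachDist Q W P := Real.sqrt_nonneg _
  rcases (colValue_nonneg hW y).eq_or_lt with h | h
  · rw [reach_eq_zero P h.ge, reach_eq_zero Q h.ge, sub_self, abs_zero]
    positivity
  · have h1 : Real.sqrt (colValue W y) * |reach P W y - reach Q W y| ≤ reachDist Q W P := by
      refine Real.le_sqrt_of_sq_le ?_
      rw [mul_pow, Real.sq_sqrt h.le, sq_abs]
      exact Finset.single_le_sum (f := fun y => colValue W y * (reach P W y - reach Q W y) ^ 2)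
        (fun z _ => mul_nonneg (colValue_nonneg hW z) (sq_nonneg _)) (Finset.mem_univ y)
    have h2 : |reach P W y - reach Q W y| ≤ (Real.sqrt (colValue W y))⁻¹ * reachDist Q W P := by
      rwa [inv_mul_eq_div, le_div_iff₀' (Real.sqrt_pos.2 h)]
    refine h2.trans (mul_le_mul_of_nonneg_right ?_ hR)
    have := Finset.single_le_sum (fun z _ => hn z) (Finset.mem_univ y)
    linarith

lemma abs_log_sub_le {r a c : ℝ} (hc : 0 < c) (hr : c ≤ r) (ha : c ≤ a) :
    |Real.log r - Real.log a| ≤ |r - a| / c := by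
  have key : ∀ {s t : ℝ}, c ≤ s → c ≤ t → Real.log s - Real.log t ≤ |s - t| / c := by
    intro s t hs ht
    have ht0 := hc.trans_le ht
    have hs0 := hc.trans_le hs
    have h := Real.log_le_sub_one_of_pos (div_pos hs0 ht0)
    rw [Real.log_div hs0.ne' ht0.ne'] at h
    have h2 : s / t - 1 = (s - t) / t := by field_simp
    rw [h2] at h
    refine h.trans ?_
    exact (div_le_div_of_nonneg_right (le_abs_self _) ht0.le).trans
      (div_le_div_of_nonneg_left (abs_nonneg _) hc ht)
  refine abs_le.2 ⟨?_, key hr ha⟩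
  have := key ha hr
  rw [abs_sub_comm] at this
  linarith

/-- Near the optimal output distribution, the information density is Lipschitz and bounded. -/
lemma exists_infoDens_lipschitz (hW : IsChannel W) (hs : IsSingular W) (hQ : Q ∈ optimalInputs W) :
    ∃ ρ L B : ℝ, 0 < ρ ∧ 0 < L ∧ 0 < B ∧ (∀ y, |infoDens Q W y| ≤ B) ∧
      ∀ P ∈ stdSimplex ℝ X, reachDist Q W P ≤ ρ →
        ∀ y, |infoDens P W y| ≤ B ∧ |infoDens P W y - infoDens Q W y| ≤ L * reachDist Q W P := by
  obtain ⟨a₀, ha0, ha1, ha⟩ := exists_reach_lower_bound hW hs hQ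
  obtain ⟨κ, hκ, hk⟩ := exists_abs_reach_sub_le hW Q
  have hbound : ∀ {P : X → ℝ}, P ∈ stdSimplex ℝ X → ∀ y,
      (0 < colValue W y → a₀ / 2 ≤ reach P W y) → |infoDens P W y| ≤ 1 + Real.log (2 / a₀) := by
    intro P hP y hy
    have hl : 0 ≤ Real.log (2 / a₀) := Real.log_nonneg (by rw [le_div_iff₀ ha0]; linarith)
    rcases (colValue_nonneg hW y).eq_or_lt with h | h
    · rw [infoDens, reach_eq_zero P h.ge, Real.log_zero, neg_zero, abs_zero]
      linarith
    · rw [abs_of_nonneg (infoDens_nonneg hP W y), infoDens]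
      have := Real.log_le_log (by positivity) (hy h)
      have h2 : Real.log (2 / a₀) = -Real.log (a₀ / 2) := by rw [← Real.log_inv, inv_div]
      linarith
  -- Within this radius r_P ≥ a₀/2 on every column that can occur, which bounds the logarithm and
  -- its slope. On dead columns both densities are 0, as `Real.log 0 = 0`.
  refine ⟨a₀ / (2 * κ), 2 * κ / a₀, 1 + Real.log (2 / a₀), by positivity, by positivity, ?_,
    fun y => hbound hQ.1 y fun h => (half_le_self ha0.le).trans (ha y h), fun P hP hR y => ?_⟩
  · have hl : 0 ≤ Real.log (2 / a₀) := Real.log_nonneg (by rw [le_div_iff₀ ha0]; linarith)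
    linarith
  · have hr : 0 < colValue W y → a₀ / 2 ≤ reach P W y := fun h => by
      have h1 := hk P y
      have h2 : κ * reachDist Q W P ≤ a₀ / 2 := by
        have := mul_le_mul_of_nonneg_left hR hκ.le
        have h3 : κ * (a₀ / (2 * κ)) = a₀ / 2 := by field_simp
        linarith
      linarith [(abs_le.1 h1).1, ha y h]
    refine ⟨hbound hP y hr, ?_⟩
    have hR0 : 0 ≤ reachDist Q W P := Real.sqrt_nonneg _
    rcases (colValue_nonneg hW y).eq_or_lt with h | h
    · rw [infoDens, infoDens, reach_eq_zero P h.ge, reach_eq_zero Q h.ge, sub_self, abs_zero]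
      positivity
    · have h1 := abs_log_sub_le (by positivity) (hr h) ((half_le_self ha0.le).trans (ha y h))
      rw [infoDens, infoDens, neg_sub_neg, abs_sub_comm]
      refine h1.trans ?_
      rw [div_le_iff₀ (by positivity)]
      refine (hk P y).trans (le_of_eq ?_)
      field_simp

/-- The conditional variance is a Lipschitz function near the optimal input distributions. -/
lemma exists_abs_avgVar_sub_le (hW : IsChannel W) (hs : IsSingular W) (hQ : Q ∈ optimalInputs W) :
    ∃ ρ L B : ℝ, 0 < ρ ∧ 0 < L ∧ 0 < B ∧ ∀ P ∈ stdSimplex ℝ X, reachDist Q W P ≤ ρ →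
      (∀ y, |infoDens P W y| ≤ B) ∧
      |avgVar P W (infoDens P W) -
        ∑ y, colValue W y * reach Q W y * (infoDens Q W y - capacity W) ^ 2| ≤
          L * (reachDist Q W P + linearGap Q W P) := by
  obtain ⟨ρ, L, B, hρ, hL, hB, hBQ, h⟩ := exists_infoDens_lipschitz hW hs hQ
  obtain ⟨κ, hκ, hk⟩ := exists_abs_reach_sub_le hW Q
  set C := capacity W with hC
  have hC0 : 0 ≤ C := capacity_nonneg hW hs hQ
  set T := ∑ y, colValue W y * (infoDens Q W y - C) ^ 2 with hT
  have hT0 : 0 ≤ T := Finset.sum_nonneg fun y _ =>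
    mul_nonneg (colValue_nonneg hW y) (sq_nonneg _)
  refine ⟨ρ, 8 * B * L + κ * T + C, B, hρ, by positivity, hB, fun P hP hR => ?_⟩
  have hR0 : 0 ≤ reachDist Q W P := Real.sqrt_nonneg _
  have hD0 := linearGap_nonneg hW hs hQ hP
  refine ⟨fun y => (h P hP hR y).1, ?_⟩
  have h1 := abs_avgVar_sub_le hW hP (fun y => (h P hP hR y).1) hBQ
    (fun y => (h P hP hR y).2)
  have h2 := avgVar_eq_sub hW P (infoDens Q W) C
  have h3 : |∑ y, outputDist P W y * (infoDens Q W y - C) ^ 2 -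
      ∑ y, colValue W y * reach Q W y * (infoDens Q W y - C) ^ 2| ≤ κ * T * reachDist Q W P := by
    rw [← Finset.sum_sub_distrib]
    refine (Finset.abs_sum_le_sum_abs _ _).trans ?_
    rw [hT, mul_right_comm, Finset.mul_sum]
    refine Finset.sum_le_sum fun y _ => ?_
    have : outputDist P W y * (infoDens Q W y - C) ^ 2 -
        colValue W y * reach Q W y * (infoDens Q W y - C) ^ 2 =
        (reach P W y - reach Q W y) * (colValue W y * (infoDens Q W y - C) ^ 2) := by
      rw [outputDist_eq hW hs]; ring
    have hn : 0 ≤ colValue W y * (infoDens Q W y - C) ^ 2 :=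
      mul_nonneg (colValue_nonneg hW y) (sq_nonneg _)
    rw [this, abs_mul, abs_of_nonneg hn]
    exact mul_le_mul_of_nonneg_right (hk P y) hn
  -- Each deficit C - condMean lies in [0, C], so its square is at most C times itself.
  have h4 : ∑ x, P x * (C - condMean W (infoDens Q W) x) ^ 2 ≤ C * linearGap Q W P := by
    rw [linearGap, Finset.mul_sum]
    refine Finset.sum_le_sum fun x _ => ?_
    have e1 := condMean_infoDens_le hW hs hQ x
    have e2 := condMean_nonneg hW (infoDens_nonneg hQ.1 W) x
    rw [sq, mul_left_comm]
    refine mul_le_mul_of_nonneg_right (by linarith) (mul_nonneg (hP.1 x) (sub_nonneg.2 e1))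
  have h5 : 0 ≤ ∑ x, P x * (C - condMean W (infoDens Q W) x) ^ 2 :=
    Finset.sum_nonneg fun x _ => mul_nonneg (hP.1 x) (sq_nonneg _)
  have e1 := abs_le.1 h1
  have e3 := abs_le.1 h3
  have p1 : 0 ≤ 8 * B * L * linearGap Q W P := by positivity
  have p2 : 0 ≤ κ * T * linearGap Q W P := by positivity
  have p3 : 0 ≤ C * reachDist Q W P := by positivity
  have p4 : 0 ≤ C * linearGap Q W P := by positivity
  rw [h2] at e1
  have hexp : (8 * B * L + κ * T + C) * (reachDist Q W P + linearGap Q W P) =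
      8 * B * (L * reachDist Q W P) + κ * T * reachDist Q W P + C * reachDist Q W P +
      8 * B * L * linearGap Q W P + κ * T * linearGap Q W P + C * linearGap Q W P := by ring
  rw [hexp]
  exact abs_le.2 ⟨by linarith [e1.1, e3.1], by linarith [e1.2, e3.2]⟩

/-- The conditional variance is bounded over all input distributions. -/
lemma avgVar_infoDens_le (hW : IsChannel W) (hs : IsSingular W) {P : X → ℝ}
    (hP : P ∈ stdSimplex ℝ X) : avgVar P W (infoDens P W) ≤ 4 * ∑ y, colValue W y := by
  refine (avgVar_le hW hP (infoDens P W) 0).trans ?_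
  rw [Finset.mul_sum]
  refine Finset.sum_le_sum fun y _ => ?_
  rw [outputDist_eq hW hs, sub_zero, infoDens, neg_sq, mul_assoc, mul_comm (4 : ℝ)]
  exact mul_le_mul_of_nonneg_left
    (neg_mul_log_sq_le (reach_nonneg hP W y) (reach_le_one hP W y)) (colValue_nonneg hW y)

/-- If the dispersion vanishes, then the conditional variance grows at most quadratically. -/
lemma exists_avgVar_le_of_eq_zero (hW : IsChannel W) (hs : IsSingular W)
    (hQ : Q ∈ optimalInputs W)
    (h0 : ∑ y, colValue W y * reach Q W y * (infoDens Q W y - capacity W) ^ 2 = 0) :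
    ∃ L : ℝ, 0 ≤ L ∧ ∀ P ∈ stdSimplex ℝ X,
      avgVar P W (infoDens P W) ≤ L * reachDist Q W P ^ 2 := by
  obtain ⟨ρ, L, B, hρ, hL, hB, hBQ, h⟩ := exists_infoDens_lipschitz hW hs hQ
  have hS : 0 ≤ ∑ y, colValue W y := Finset.sum_nonneg fun y _ => colValue_nonneg hW y
  refine ⟨L ^ 2 + 4 * (∑ y, colValue W y) / ρ ^ 2, by positivity, fun P hP => ?_⟩
  have hR0 : 0 ≤ reachDist Q W P := Real.sqrt_nonneg _
  rw [add_mul]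
  rcases le_total (reachDist Q W P) ρ with hR | hR
  · have h1 : avgVar P W (infoDens P W) ≤ L ^ 2 * reachDist Q W P ^ 2 := by
      refine (avgVar_le hW hP (infoDens P W) (capacity W)).trans ?_
      calc _ ≤ ∑ y, outputDist P W y * (L ^ 2 * reachDist Q W P ^ 2) := by
            refine Finset.sum_le_sum fun y _ => ?_
            rcases (colValue_nonneg hW y).eq_or_lt with hy | hy
            · simp [outputDist_eq hW hs, ← hy]
            · refine mul_le_mul_of_nonneg_left ?_ (outputDist_nonneg hW hP y)
              rw [Finset.sum_eq_zero_iff_of_nonneg fun y _ => mul_nonneg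
                (mul_nonneg (colValue_nonneg hW y) (reach_nonneg hQ.1 W y)) (sq_nonneg _)] at h0
              -- Zero dispersion makes Q's density equal to C on all live columns, so P's density
              -- stays within LR of C.
              have h2 := h0 y (Finset.mem_univ y)
              rw [mul_eq_zero, or_iff_right (mul_pos hy (reach_pos_of_optimal hW hs hQ hy)).ne',
                sq_eq_zero_iff, sub_eq_zero] at h2
              rw [← h2, ← mul_pow, ← sq_abs]
              exact pow_le_pow_left₀ (abs_nonneg _) (h P hP hR y).2 2
        _ = _ := by rw [← Finset.sum_mul, sum_outputDist hW hP, one_mul]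
    have : 0 ≤ 4 * (∑ y, colValue W y) / ρ ^ 2 * reachDist Q W P ^ 2 := by positivity
    linarith
  · have h1 := avgVar_infoDens_le hW hs hP
    have h2 : 4 * (∑ y, colValue W y) ≤ 4 * (∑ y, colValue W y) / ρ ^ 2 * reachDist Q W P ^ 2 := by
      rw [div_mul_eq_mul_div, le_div_iff₀ (by positivity)]
      exact mul_le_mul_of_nonneg_left (pow_le_pow_left₀ hρ.le hR 2) (by positivity)
    have : 0 ≤ L ^ 2 * reachDist Q W P ^ 2 := by positivity
    linarith

end Perturbation

/-! ### Inverting the normal distribution function -/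

section Quantile

/-- The quantile function is locally Lipschitz from above. -/
lemma exists_le_stdNormalInv_add {ε : ℝ} (hε : ε < 1) :
    ∃ η₀ c : ℝ, 0 < η₀ ∧ 0 < c ∧ ∀ s η : ℝ, 0 < η → η ≤ η₀ → stdNormalCDF s ≤ ε + η →
      s ≤ stdNormalInv ε + c * η := by
  set z := stdNormalInv ε with hz
  obtain ⟨κ, hκ, hk⟩ := exists_le_stdNormalCDF_sub (|z| + 2)
  refine ⟨κ / 2, 2 / κ, by positivity, by positivity, fun s η hη hη0 hs => ?_⟩
  by_contra! hcon
  have hgt : ∀ t, z < t → ε ≤ stdNormalCDF t := fun t ht => by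
    have hne : {t : ℝ | ε ≤ stdNormalCDF t}.Nonempty := by
      obtain ⟨t, ht⟩ := ((ProbabilityTheory.tendsto_cdf_atTop
        (ProbabilityTheory.gaussianReal 0 1)).eventually (lt_mem_nhds hε)).exists
      exact ⟨t, ht.le⟩
    obtain ⟨u, hu, hut⟩ := exists_lt_of_csInf_lt hne ht
    exact le_trans hu (ProbabilityTheory.monotone_cdf _ hut.le)
  set u := η / κ with hu
  have hu0 : 0 < u := by positivity
  have hu1 : u ≤ 1 / 2 := by rw [hu, div_le_iff₀ hκ]; linarith
  have hcu : 2 / κ * η = 2 * u := by rw [hu]; ring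
  rw [hcu] at hcon
  -- Truncation keeps s' where the density is at least κ. Stepping back by 3u/2 stays above z, where
  -- Φ ≥ ε, yet changes Φ by at least 3η/2 > η.
  set s' := min s (z + 2) with hs'
  have h1 : z + 2 * u < s' := lt_min hcon (by linarith)
  have h2 : stdNormalCDF s' ≤ ε + η :=
    le_trans (ProbabilityTheory.monotone_cdf _ (min_le_left _ _)) hs
  have h3 := hk (s' - 3 / 2 * u) s' (by linarith [neg_abs_le z]) (by linarith)
    ((min_le_right _ _).trans (by linarith [le_abs_self z]))
  have h4 := hgt (s' - 3 / 2 * u) (by linarith)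
  have h5 : κ * (s' - (s' - 3 / 2 * u)) = 3 / 2 * η := by rw [hu]; field_simp; ring
  linarith

end Quantile

/-! ### Compositions and trivial codes -/

section Codes

variable {X Y : Type*}

lemma exists_composition [Fintype X] {N M : ℕ} (c : Code X Y N M) (hN : 0 < N) (hM : 0 < M)
    (hcc : c.ConstantComposition) :
    ∃ P ∈ stdSimplex ℝ X, ∀ m, empiricalDist (c.enc m) = P :=
  ⟨empiricalDist (c.enc ⟨0, hM⟩), empiricalDist_mem hN _, fun m => hcc m _⟩

lemma numMessages_pos (N : ℕ) (R : ℝ) : 0 < numMessages N R :=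
  Nat.ceil_pos.2 (Real.exp_pos _)

/-- The trivial code, which ignores the message. -/
def trivialCode (x : X) (N : ℕ) {M : ℕ} (hM : 0 < M) : Code X Y N M where
  enc _ _ := x
  dec _ := ⟨0, hM⟩

variable [Fintype Y] [Nonempty X] {W : X → Y → ℝ}

/-- A single message is never decoded wrongly. Nonemptiness is needed for the supremum defining the
maximal size to be attained. -/
lemma one_mem_codeSizesCC (hW : IsChannel W) (N : ℕ) {ε : ℝ} (hε : 0 < ε) :
    1 ∈ codeSizesCC W N ε := by
  have h1 : numMessages N 0 = 1 := by simp [numMessages]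
  refine ⟨0, le_rfl, h1.symm, ?_⟩
  refine le_trans (csInf_le ⟨0, ?_⟩
    ⟨trivialCode (Classical.arbitrary X) N (numMessages_pos N 0), fun _ _ => rfl, rfl⟩) ?_
  · rintro _ ⟨c, -, rfl⟩
    exact avgError_nonneg hW c
  · refine le_trans (le_of_eq ?_) hε.le
    have hsub : Subsingleton (Fin (numMessages N 0)) := by rw [h1]; infer_instance
    rw [avgError, Finset.sum_eq_zero, mul_zero]
    refine fun m _ => Finset.sum_eq_zero fun y hy => ?_
    exact absurd (Subsingleton.elim _ _) (Finset.mem_filter.1 hy).2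

end Codes

/-! ### Uniformity over compositions and conclusion -/

section Main

variable {X Y : Type*} [Fintype X] [Fintype Y] [Nonempty X] {W : X → Y → ℝ}

/-- Completing the square: the device by which losses of order N absorb deviations of order √N. -/
lemma mul_sub_sq_le (A x : ℝ) {κ : ℝ} (hκ : 0 < κ) : A * x - κ * x ^ 2 ≤ A ^ 2 / (4 * κ) := by
  rw [le_div_iff₀ (by positivity)]
  nlinarith [sq_nonneg (A - 2 * κ * x)]

lemma sqrt_sub_mul_le {V V₀ T : ℝ} (hV : 0 ≤ V) (hV₀ : 0 < V₀) (h : |V - V₀| ≤ T) (z : ℝ) :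
    (Real.sqrt V - Real.sqrt V₀) * z ≤ T / Real.sqrt V₀ * |z| := by
  have h1 : V - V₀ = (Real.sqrt V - Real.sqrt V₀) * (Real.sqrt V + Real.sqrt V₀) := by
    have a1 := Real.sq_sqrt hV
    have a2 := Real.sq_sqrt hV₀.le
    linear_combination a2 - a1
  have h2 : |Real.sqrt V - Real.sqrt V₀| * Real.sqrt V₀ ≤ T := by
    refine le_trans ?_ h
    rw [h1, abs_mul, abs_of_nonneg (show 0 ≤ Real.sqrt V + Real.sqrt V₀ by positivity)]
    exact mul_le_mul_of_nonneg_left (by linarith [Real.sqrt_nonneg V]) (abs_nonneg _)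
  refine (le_abs_self _).trans ?_
  rw [abs_mul]
  refine mul_le_mul_of_nonneg_right ?_ (abs_nonneg _)
  rwa [le_div_iff₀ (Real.sqrt_pos.2 hV₀)]

lemma log_card_le_mutualInfo (hW : IsChannel W) (hs : IsSingular W) {ε : ℝ} (hε : ε < 1)
    {N M : ℕ} {c : Code X Y N M} (hN : 0 < N) (hM : 0 < M) (he : avgError W c ≤ ε) {P : X → ℝ}
    (hP : P ∈ stdSimplex ℝ X) (hc : ∀ m, empiricalDist (c.enc m) = P) :
    Real.log M ≤ N * mutualInfo P W +
      Real.sqrt (N * avgVar P W (infoDens P W) * (2 / (1 - ε))) + Real.log (2 / (1 - ε)) := by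
  have := log_card_le_chebyshev hW c hM hN hc hP (le_outputDist_mul_exp hW hs hP) hε he
  rwa [← mutualInfo_eq_avgMean hW hs] at this

/-- The bound on the size of constant composition codes for a singular channel without
dispersion. -/
lemma exists_log_card_le_of_eq_zero (hW : IsChannel W) (hs : IsSingular W) {ε : ℝ} (hε : ε < 1)
    (hV : epsDispersion ε W = 0) :
    ∃ K : ℝ, ∀ (N M : ℕ) (c : Code X Y N M), 0 < N → 0 < M → c.ConstantComposition →
      avgError W c ≤ ε → Real.log M ≤ N * capacity W +
        Real.sqrt (N * epsDispersion ε W) * stdNormalInv ε + K := by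
  obtain ⟨Q, hQ⟩ := exists_mem_optimalInputs hW hs
  rw [epsDispersion_eq hW hs hQ ε] at hV ⊢
  set C := capacity W with hC
  set k := 2 / (1 - ε) with hk
  have hε' : 0 < 1 - ε := by linarith
  have hk0 : 0 < k := by positivity
  obtain ⟨L, hL0, hL⟩ := exists_avgVar_le_of_eq_zero hW hs hQ hV
  refine ⟨L * k + Real.log k, fun N M c hN hM hcc he => ?_⟩
  obtain ⟨P, hP, hc⟩ := exists_composition c hN hM hcc
  have h1 := log_card_le_mutualInfo hW hs hε hN hM he hP hc
  have h2 := mutualInfo_le_sub hW hs hQ hP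
  have h3 := linearGap_nonneg hW hs hQ hP
  set R := reachDist Q W P with hR
  have hR0 : 0 ≤ R := Real.sqrt_nonneg _
  set x := Real.sqrt N with hx
  have hx2 : x ^ 2 = N := Real.sq_sqrt (by positivity)
  -- Since V(P) ≤ LR², the Chebyshev term is linear in √N·R, and the loss N R²/4 absorbs it at the
  -- cost Lk.
  have h4 : Real.sqrt (N * avgVar P W (infoDens P W) * k) ≤ Real.sqrt (L * k) * (x * R) := by
    refine Real.sqrt_le_iff.2 ⟨by positivity, ?_⟩
    rw [mul_pow, Real.sq_sqrt (by positivity), mul_pow, hx2]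
    calc N * avgVar P W (infoDens P W) * k ≤ N * (L * R ^ 2) * k := by gcongr; exact hL P hP
      _ = L * k * (N * R ^ 2) := by ring
  have h5 := mul_sub_sq_le (Real.sqrt (L * k)) (x * R) (show (0 : ℝ) < 1 / 4 by norm_num)
  rw [Real.sq_sqrt (by positivity), mul_pow, hx2] at h5
  have h6 : (N : ℝ) * mutualInfo P W ≤ N * (C - R ^ 2 / 4) :=
    mul_le_mul_of_nonneg_left (by linarith) (Nat.cast_nonneg N)
  rw [hV, mul_zero, Real.sqrt_zero, zero_mul]
  linarith

set_option maxHeartbeats 1000000 in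
/-- The bound on the size of constant composition codes for a singular channel with positive
dispersion. -/
lemma exists_log_card_le_of_pos (hW : IsChannel W) (hs : IsSingular W) {ε : ℝ} (hε : ε < 1)
    (hV : 0 < epsDispersion ε W) :
    ∃ K : ℝ, ∀ (N M : ℕ) (c : Code X Y N M), 0 < N → 0 < M → c.ConstantComposition →
      avgError W c ≤ ε → Real.log M ≤ N * capacity W +
        Real.sqrt (N * epsDispersion ε W) * stdNormalInv ε + K := by
  obtain ⟨Q, hQ⟩ := exists_mem_optimalInputs hW hs
  rw [epsDispersion_eq hW hs hQ ε] at hV ⊢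
  set C := capacity W with hC
  set z := stdNormalInv ε with hz
  set V₀ := ∑ y, colValue W y * reach Q W y * (infoDens Q W y - C) ^ 2 with hV₀
  have hV0 : 0 ≤ V₀ := hV.le
  set k := 2 / (1 - ε) with hk
  have hε' : 0 < 1 - ε := by linarith
  have hk0 : 0 < k := by positivity
  obtain ⟨ρ, L, B, hρ, hL, hB, hLB⟩ := exists_abs_avgVar_sub_le hW hs hQ
  obtain ⟨η₀, c₁, hη₀, hc₁, hquant⟩ := exists_le_stdNormalInv_add hε
  have hC0 : 0 ≤ C := capacity_nonneg hW hs hQ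
  set S := 4 * ∑ y, colValue W y with hS
  -- The coefficient of √N in the crude Chebyshev bound; the part with |z| pays for inserting the
  -- target second-order term.
  set G := Real.sqrt (S * k) + Real.sqrt V₀ * |z| with hG
  -- Keeps the Lipschitz estimate valid and V(P) ≥ V₀/2.
  set ρ' := min ρ (V₀ / (2 * L)) with hρ'
  have hρ'0 : 0 < ρ' := by positivity
  -- If R + D > ρ', then D or R is at least ρ'/2, so κ bounds the capacity loss D + R²/4 from below.
  set κ := min (ρ' / 2) (ρ' ^ 2 / 16) with hκ
  have hκ0 : 0 < κ := by positivity
  set A := |z| * L / Real.sqrt V₀ with hA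
  have hA0 : 0 ≤ A := by positivity
  set b := 2 + 250 * B with hb
  have hb0 : 0 < b := by positivity
  set g := Real.sqrt (V₀ / 2) with hg
  have hg0 : 0 < g := Real.sqrt_pos.2 (by positivity)
  set K₁ := G ^ 2 / (4 * κ) + |Real.log k| with hK₁
  set K₂ := b / (g * η₀) * G + |Real.log k| with hK₂
  set K₃ := c₁ * b + A ^ 2 + C * A ^ 2 / 4 with hK₃
  have hG0 : 0 ≤ G := by positivity
  refine ⟨K₁ + K₂ + K₃, fun N M c hN hM hcc he => ?_⟩
  have hK₁0 : 0 ≤ K₁ := by positivity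
  have hK₂0 : 0 ≤ K₂ := by positivity
  have hK₃0 : 0 ≤ K₃ := by positivity
  obtain ⟨P, hP, hc⟩ := exists_composition c hN hM hcc
  have hI := mutualInfo_le_sub hW hs hQ hP
  have hD0 := linearGap_nonneg hW hs hQ hP
  have hDC : linearGap Q W P ≤ C := linearGap_le_capacity hW hQ hP
  set R := reachDist Q W P with hR
  set D := linearGap Q W P with hD
  set V := avgVar P W (infoDens P W) with hVP
  have hR0 : 0 ≤ R := Real.sqrt_nonneg _
  set x := Real.sqrt N with hx
  have hx0 : 0 < x := Real.sqrt_pos.2 (by positivity)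
  have hx2 : x ^ 2 = N := Real.sq_sqrt (by positivity)
  have hNx : Real.sqrt (N * V₀) = x * Real.sqrt V₀ := Real.sqrt_mul (by positivity) _
  have hcrude : Real.log M ≤ N * mutualInfo P W +
      Real.sqrt (N * V₀) * z + x * G + |Real.log k| := by
    have h1 := log_card_le_mutualInfo hW hs hε hN hM he hP hc
    have h2 : Real.sqrt (N * V * k) ≤ x * Real.sqrt (S * k) := by
      rw [mul_assoc, Real.sqrt_mul (by positivity)]
      refine mul_le_mul_of_nonneg_left (Real.sqrt_le_sqrt ?_) hx0.le
      exact mul_le_mul_of_nonneg_right (avgVar_infoDens_le hW hs hP) hk0.le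
    have h3 : 0 ≤ x * Real.sqrt V₀ * (z + |z|) :=
      mul_nonneg (by positivity) (by linarith [neg_abs_le z])
    rw [hNx, hG]
    linarith [le_abs_self (Real.log k)]
  rcases lt_or_ge ρ' (R + D) with hfar | hnear
  · have h1 : κ ≤ D + R ^ 2 / 4 := by
      rcases le_total (ρ' / 2) D with h | h
      · exact (min_le_left _ _).trans (by nlinarith [sq_nonneg R])
      · refine (min_le_right _ _).trans ?_
        have : ρ' / 2 ≤ R := by linarith
        nlinarith
    have h2 : (N : ℝ) * mutualInfo P W ≤ N * (C - κ) :=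
      mul_le_mul_of_nonneg_left (by linarith) (Nat.cast_nonneg N)
    have h3 := mul_sub_sq_le G x hκ0
    rw [hx2] at h3
    linarith
  · have hRρ : R ≤ ρ := by linarith [min_le_left ρ (V₀ / (2 * L))]
    obtain ⟨hBP, hVL⟩ := hLB P hP hRρ
    have hVV : V₀ / 2 ≤ V := by
      have h1 : L * (R + D) ≤ V₀ / 2 := by
        have := mul_le_mul_of_nonneg_left (hnear.trans (min_le_right _ _)) hL.le
        have h2 : L * (V₀ / (2 * L)) = V₀ / 2 := by field_simp
        linarith
      linarith [(abs_le.1 hVL).1]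
    have hVpos : 0 < V := by linarith
    have hNV : Real.sqrt (N * V) = x * Real.sqrt V := Real.sqrt_mul (by positivity) _
    have hgV : g ≤ Real.sqrt V := Real.sqrt_le_sqrt hVV
    set σ := Real.sqrt (N * V) with hσ
    have hσ0 : 0 < σ := Real.sqrt_pos.2 (by positivity)
    have hINC : (N : ℝ) * mutualInfo P W ≤ N * (C - D - R ^ 2 / 4) :=
      mul_le_mul_of_nonneg_left hI (Nat.cast_nonneg N)
    -- Φ can be inverted only when the error b/σ is small. Otherwise N is bounded and the crude
    -- bound suffices.
    rcases le_or_gt (b / σ) η₀ with hη | hη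
    · have hclt := stdNormalCDF_log_card_le hW c hM hN hc hP (le_outputDist_mul_exp hW hs hP)
        hB hBP hVpos he
      rw [← mutualInfo_eq_avgMean hW hs] at hclt
      have h1 := hquant _ _ (by positivity) hη hclt
      rw [div_le_iff₀ hσ0] at h1
      have h2 : (z + c₁ * (b / σ)) * σ = σ * z + c₁ * b := by field_simp
      have h3 : σ * z ≤ x * Real.sqrt V₀ * z + A * x * (R + D) := by
        have e4 := sqrt_sub_mul_le hVpos.le hV hVL z
        have e5 := mul_le_mul_of_nonneg_left e4 hx0.le
        have e6 : x * (L * (R + D) / Real.sqrt V₀ * |z|) = A * x * (R + D) := by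
          rw [hA]; ring
        rw [hNV]
        linarith
      have h4 := mul_sub_sq_le A (x * R) (show (0 : ℝ) < 1 / 4 by norm_num)
      -- The deviation A√N·D meets the loss N·D: the difference is D(A√N - N) ≤ DA²/4, and D ≤ C.
      have h5 := mul_le_mul_of_nonneg_left (mul_sub_sq_le A x one_pos) hD0
      have h6 : D * (A ^ 2 / (4 * 1)) ≤ C * A ^ 2 / 4 := by
        have := mul_le_mul_of_nonneg_right hDC (sq_nonneg A)
        linarith
      rw [mul_pow, hx2] at h4
      rw [hx2] at h5
      rw [hNx]
      linarith
    · have h1 : x ≤ b / (g * η₀) := by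
        rw [lt_div_iff₀ hσ0] at hη
        rw [le_div_iff₀ (by positivity)]
        have : x * g ≤ σ := by rw [hNV]; exact mul_le_mul_of_nonneg_left hgV hx0.le
        have := mul_le_mul_of_nonneg_left this hη₀.le
        linarith
      have h2 := mul_le_mul_of_nonneg_right h1 hG0
      have h3 : (N : ℝ) * (C - D - R ^ 2 / 4) ≤ N * C :=
        mul_le_mul_of_nonneg_left (by nlinarith [sq_nonneg R]) (Nat.cast_nonneg N)
      linarith

lemma exists_avgError_eq_minErrorCC (W : X → Y → ℝ) (N : ℕ) (R : ℝ) :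
    ∃ c : Code X Y N (numMessages N R), c.ConstantComposition ∧ avgError W c = minErrorCC W N R := by
  set M := numMessages N R
  have hfin : Finite (Code X Y N M) :=
    Finite.of_injective (fun c : Code X Y N M => (c.enc, c.dec)) fun c d h => by
      cases c; cases d; simpa using h
  set s := {e | ∃ c : Code X Y N M, c.ConstantComposition ∧ e = avgError W c} with hs
  have hsf : s.Finite := (Set.finite_range fun c : Code X Y N M => avgError W c).subset
    fun e ⟨c, _, h⟩ => ⟨c, h.symm⟩
  have hne : s.Nonempty :=
    ⟨_, trivialCode (Classical.arbitrary X) N (numMessages_pos N R), fun _ _ => rfl, rfl⟩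
  obtain ⟨c, hc, h⟩ := hne.csInf_mem hsf
  exact ⟨c, hc, h.symm⟩

/-- The third-order converse for constant composition codes over a singular channel. The argument
does not distinguish symmetric from asymmetric channels. -/
lemma exists_log_maxCodeSizeCC_le (hW : IsChannel W) (hs : IsSingular W) {ε : ℝ} (hε0 : 0 < ε)
    (hε : ε < 1) :
    ∃ K : ℝ, 0 < K ∧ ∀ N : ℕ, 1 ≤ N → Real.log (maxCodeSizeCC W N ε : ℝ) ≤
      (N : ℝ) * capacity W + Real.sqrt ((N : ℝ) * epsDispersion ε W) * stdNormalInv ε + K := by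
  have hV : 0 ≤ epsDispersion ε W := by
    obtain ⟨Q, hQ⟩ := exists_mem_optimalInputs hW hs
    rw [epsDispersion_eq hW hs hQ ε]
    exact Finset.sum_nonneg fun y _ => mul_nonneg
      (mul_nonneg (colValue_nonneg hW y) (reach_nonneg hQ.1 W y)) (sq_nonneg _)
  obtain ⟨K, hK⟩ := hV.eq_or_lt.elim
    (fun h => exists_log_card_le_of_eq_zero hW hs hε h.symm)
    (fun h => exists_log_card_le_of_pos hW hs hε h)
  refine ⟨max K 1, by positivity, fun N hN => ?_⟩
  set T := (N : ℝ) * capacity W + Real.sqrt ((N : ℝ) * epsDispersion ε W) * stdNormalInv ε + K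
    with hT
  have hmem : ∀ M ∈ codeSizesCC W N ε, Real.log M ≤ T := by
    rintro M ⟨R, -, rfl, hR⟩
    obtain ⟨c, hcc, he⟩ := exists_avgError_eq_minErrorCC W N R
    exact hK N _ c hN (numMessages_pos N R) hcc (he.trans_le hR)
  have hpos : ∀ M ∈ codeSizesCC W N ε, 0 < M := by
    rintro M ⟨R, -, rfl, -⟩
    exact numMessages_pos N R
  have hbdd : BddAbove (codeSizesCC W N ε) := by
    refine ⟨⌈Real.exp T⌉₊, fun M hM => ?_⟩
    have h1 := (Real.log_le_iff_le_exp (Nat.cast_pos.2 (hpos M hM))).1 (hmem M hM)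
    exact_mod_cast h1.trans (Nat.le_ceil _)
  have h := hmem _ (Nat.sSup_mem ⟨1, one_mem_codeSizesCC hW N hε0⟩ hbdd)
  have := le_max_left K 1
  rw [maxCodeSizeCC]
  linarith

end Main

end DMC

end

theorem theorem4 {X Y : Type*} [Fintype X] [Fintype Y] [Nonempty X] [Nonempty Y]
    (W : X → Y → ℝ) (hW : DMC.IsChannel W)
    (hsing : DMC.IsSingular W) (hasym : ¬ DMC.IsSymmetric W) :
    (∀ ε : ℝ, 0 < ε → ε < 1 / 2 →
      ∃ K : ℝ, 0 < K ∧ ∀ N : ℕ, 1 ≤ N →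
        Real.log (DMC.maxCodeSizeCC W N ε : ℝ) ≤
          (N : ℝ) * DMC.capacity W
            + Real.sqrt ((N : ℝ) * DMC.epsDispersion ε W) * DMC.stdNormalInv ε + K) ∧
    (∀ ε : ℝ, 1 / 2 < ε → ε < 1 → 0 < DMC.epsDispersion ε W →
      ∃ K : ℝ, 0 < K ∧ ∀ N : ℕ, 1 ≤ N →
        Real.log (DMC.maxCodeSizeCC W N ε : ℝ) ≤
          (N : ℝ) * DMC.capacity W
            + Real.sqrt ((N : ℝ) * DMC.epsDispersion ε W) * DMC.stdNormalInv ε + K) := by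
  exact ⟨fun ε h0 h1 => DMC.exists_log_maxCodeSizeCC_le hW hsing h0 (by linarith),
    fun ε h0 h1 _ => DMC.exists_log_maxCodeSizeCC_le hW hsing (by linarith) h1⟩
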